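/- A finite Hopf C*-algebra is a finite-dimensional unital C*-algebra $A$ that is a Hopf algebra over $\mathbb C$ whose comultiplication $\Delta$ and counit $\varepsilon$ are $*$-homomorphisms and whose antipode $S$ is anti-multiplicative with $S(S(a)^*)^*=a$. A normalized invariant integral on $A$ is a linear functional $\varphi$ with $(\varphi\otimes\iota)\Delta(a)=(\iota\otimes\varphi)\Delta(a)=\varphi(a)1$, $\varphi\circ S=\varphi$ and $\varphi(1)=1$; put $\|a\|_{\varphi}=\varphi(aa^*)^{1/2}$. Let $A,B$ be finite Hopf C*-algebras with a non-degenerate pairing, i.e. a bilinear form $\langle\cdot,\cdot\rangle$ on $A\times B$ that separates the points of $A$ and of $B$ and satisfies $\langle\Delta(a),b_1\otimes b_2\rangle=\langle a,b_1b_2\rangle$, $\langle a_1\otimes a_2,\Delta(b)\rangle=\langle a_1a_2,b\rangle$, $\langle a^*,b\rangle=\overline{\langle a,S_B(b)^*\rangle}$, $\langle a,1_B\rangle=\varepsilon_A(a)$, $\langle 1_A,b\rangle=\varepsilon_B(b)$, $\langle S_A(a),b\rangle=\langle a,S_B(b)\rangle$. The quantum double $D(A,B)$ is the vector space $A\otimes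 B$, with $(a,b):=a\otimes b$, unit $(1_A,1_B)$, product and involution $$(a,b)(a',b')=\sum (aa'_{(2)},b_{(2)}b')\,\langle a'_{(1)},S_B^{-1}(b_{(3)})\rangle\langle a'_{(3)},b_{(1)}\rangle,$$ $$(a,b)^*=\sum (a^*_{(2)},b^*_{(2)})\,\langle a^*_{(3)},b^*_{(1)}\rangle\langle a^*_{(1)},S_B(b_{(3)})^*\rangle .$$ Let $\varphi_A,\varphi_B$ be normalized invariant integrals on $A,B$, and let $\theta$ be the linear functional on $D(A,B)$ with $\theta((a,b))=\varphi_A(a)\varphi_B(b)$. For $x\in D(A,B)$ let $\|x\|_\theta=\theta(xx^*)^{1/2}$, and let $\|x\|_{C^*}$ be the operator norm of $y\mapsto xy$ on $D(A,B)$ equipped with the GNS inner product $\langle x,y\rangle_\theta=\theta(y^*x)$. Let $i_A(a)=(a,1_B)$ and $i_B(b)=(1_A,b)$. Then: 1. $\theta=\varphi_A\otimes\varphi_B$, and $\theta$ is a normalized invariant integral on $D(A,B)$: $\theta((1_A,1_B))=1$, and $(\theta\otimes\iota)\Delta_D(x)=(\iota\otimes\theta)\Delta_D(x)=\theta(x)(1_A,1_B)$,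 $\theta\circ S_D=\theta$. This holds both for the structure maps $\Delta_D(a,b)=\sum(a_{(1)},b_{(1)})\otimes(a_{(2)},b_{(2)})$, $S_D(a,b)=\sum(S_Aa_{(2)},S_Bb_{(2)})\langle a_{(1)},S_Bb_{(3)}\rangle\langle a_{(3)},b_{(1)}\rangle$, and for $\Delta_D(a,b)=\sum(a_{(2)},b_{(1)})\otimes(a_{(1)},b_{(2)})$, $S_D(a,b)=(1_A,S_Bb)(S_Aa,1_B)$. Moreover $\theta(xx^*)>0$ and $\theta(x^*x)>0$ for all $x\neq0$. 2. For all $a\in A$, $b\in B$: $\theta((a,b)(a,b)^*)=\varphi_A(aa^*)\varphi_B(bb^*)$, and hence $\|(a,b)\|_\theta=\|a\|_{\varphi_A}\|b\|_{\varphi_B}$. 3. The canonical embeddings are isometric for these norms: $\|i_A(a)\|_\theta=\|a\|_{\varphi_A}$ and $\|i_B(b)\|_\theta=\|b\|_{\varphi_B}$ for all $a\in A$, $b\in B$. 4. They are also isometric for the C*-norms: $\|i_A(a)\|_{C^*}=\|a\|$ and $\|i_B(b)\|_{C^*}=\|b\|$, where $\|a\|,\|b\|$ are the C*-norms of $A$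 and $B$. -/

import Mathlib

open scoped TensorProduct ComplexConjugate ComplexOrder

set_option linter.unusedSectionVars false

noncomputable section

/-- A finite Hopf C*-algebra: a finite-dimensional Hopf algebra over `ℂ` that carries a
(unital) C*-algebra structure, such that the comultiplication and the counit are
`*`-homomorphisms and the antipode `S` is anti-multiplicative with `S(S(a)*)* = a`.
Completeness of the norm is automatic in finite dimension. -/
class FiniteHopfCStar (A : Type*) [NormedRing A] [StarRing A] [HopfAlgebra ℂ A] : Prop
    extends CStarRing A, StarModule ℂ A, NormSMulClass ℂ A, FiniteDimensional ℂ A where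
  comul_star : ∀ a : A, Coalgebra.comul (R := ℂ) (star a) = star (Coalgebra.comul (R := ℂ) a)
  counit_star : ∀ a : A, Coalgebra.counit (R := ℂ) (star a) = conj (Coalgebra.counit (R := ℂ) a)
  antipode_mul_rev : ∀ a b : A, HopfAlgebra.antipode ℂ (a * b) =
    HopfAlgebra.antipode ℂ b * HopfAlgebra.antipode ℂ a
  star_antipode_star_antipode : ∀ a : A,
    star (HopfAlgebra.antipode ℂ (star (HopfAlgebra.antipode ℂ a))) = a

/-- `φ` is an invariant integral with respect to the comultiplication `Δ`, the unit `e` and the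
antipode `S`: `(φ ⊗ ι)Δ(x) = (ι ⊗ φ)Δ(x) = φ(x) e` and `φ ∘ S = φ`. -/
structure IsInvariantIntegral {V : Type*} [AddCommGroup V] [Module ℂ V]
    (Δ : V →ₗ[ℂ] V ⊗[ℂ] V) (e : V) (S : V →ₗ[ℂ] V) (φ : V →ₗ[ℂ] ℂ) : Prop where
  left_inv : ∀ x, TensorProduct.lid ℂ V (TensorProduct.map φ LinearMap.id (Δ x)) = φ x • e
  right_inv : ∀ x, TensorProduct.rid ℂ V (TensorProduct.map LinearMap.id φ (Δ x)) = φ x • e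
  antipode_inv : ∀ x, φ (S x) = φ x

/-- The norm `a ↦ φ(a a*)^{1/2}` attached to a functional on a `*`-algebra. -/
def integralNorm {A : Type*} [NormedRing A] [StarRing A] [Module ℂ A] (φ : A →ₗ[ℂ] ℂ) (a : A) : ℝ :=
  √(φ (a * star a)).re

/-- The threefold coproduct `a ↦ ∑ a₁ ⊗ (a₂ ⊗ a₃)`. -/
def comul₃ (A : Type*) [Ring A] [HopfAlgebra ℂ A] : A →ₗ[ℂ] A ⊗[ℂ] (A ⊗[ℂ] A) :=
  TensorProduct.map LinearMap.id Coalgebra.comul ∘ₗ Coalgebra.comul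

/-- `x ⊗ (y ⊗ z) ↦ z ⊗ (y ⊗ x)`. -/
def reverse₃ (V : Type*) [AddCommGroup V] [Module ℂ V] :
    V ⊗[ℂ] (V ⊗[ℂ] V) →ₗ[ℂ] V ⊗[ℂ] (V ⊗[ℂ] V) :=
  (TensorProduct.assoc ℂ V V V).toLinearMap ∘ₗ (TensorProduct.comm ℂ V (V ⊗[ℂ] V)).toLinearMap ∘ₗ
    TensorProduct.map LinearMap.id (TensorProduct.comm ℂ V V).toLinearMap

/-- `(u ⊗ (v ⊗ w)) ⊗ (z ⊗ (y ⊗ x)) ↦ f(u ⊗ z) g(w ⊗ x) v ⊗ y`. -/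
def contractOuter {V W : Type*} [AddCommGroup V] [Module ℂ V] [AddCommGroup W] [Module ℂ W]
    (f g : V ⊗[ℂ] W →ₗ[ℂ] ℂ) :
    (V ⊗[ℂ] (V ⊗[ℂ] V)) ⊗[ℂ] (W ⊗[ℂ] (W ⊗[ℂ] W)) →ₗ[ℂ] V ⊗[ℂ] W :=
  (TensorProduct.lid ℂ (V ⊗[ℂ] W)).toLinearMap ∘ₗ
    TensorProduct.map f
      ((TensorProduct.rid ℂ (V ⊗[ℂ] W)).toLinearMap ∘ₗ TensorProduct.map LinearMap.id g ∘ₗ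
        (TensorProduct.tensorTensorTensorComm ℂ V V W W).toLinearMap) ∘ₗ
    (TensorProduct.tensorTensorTensorComm ℂ V (V ⊗[ℂ] V) W (W ⊗[ℂ] W)).toLinearMap

section Double

variable {A B : Type*} [NormedRing A] [StarRing A] [HopfAlgebra ℂ A] [FiniteHopfCStar A]
  [NormedRing B] [StarRing B] [HopfAlgebra ℂ B] [FiniteHopfCStar B]

/-- The inverse of the antipode, `S⁻¹(b) = S(b*)*`. -/
def antipodeInv (B : Type*) [NormedRing B] [StarRing B] [HopfAlgebra ℂ B] [FiniteHopfCStar B] :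
    B →ₗ[ℂ] B where
  toFun b := star (HopfAlgebra.antipode ℂ (star b))
  map_add' x y := by simp
  map_smul' c x := by simp

theorem antipodeInv_antipode (b : B) : antipodeInv B (HopfAlgebra.antipode ℂ b) = b :=
  FiniteHopfCStar.star_antipode_star_antipode b

theorem antipode_antipodeInv (b : B) : HopfAlgebra.antipode ℂ (antipodeInv B b) = b := by
  have h := FiniteHopfCStar.star_antipode_star_antipode (star b)
  exact star_injective h

/-- A pairing of finite Hopf C*-algebras. -/
structure IsHopfPairing (p : A →ₗ[ℂ] B →ₗ[ℂ] ℂ) : Prop where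
  comul_left : ∀ (a : A) (b₁ b₂ : B),
    LinearMap.mul' ℂ ℂ (TensorProduct.map (p.flip b₁) (p.flip b₂) (Coalgebra.comul (R := ℂ) a)) =
      p a (b₁ * b₂)
  comul_right : ∀ (a₁ a₂ : A) (b : B),
    LinearMap.mul' ℂ ℂ (TensorProduct.map (p a₁) (p a₂) (Coalgebra.comul (R := ℂ) b)) =
      p (a₁ * a₂) b
  star_left : ∀ (a : A) (b : B), p (star a) b = conj (p a (star (HopfAlgebra.antipode ℂ b)))
  one_right : ∀ a : A, p a 1 = Coalgebra.counit (R := ℂ) a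
  one_left : ∀ b : B, p 1 b = Coalgebra.counit (R := ℂ) b
  antipode_left : ∀ (a : A) (b : B),
    p (HopfAlgebra.antipode ℂ a) b = p a (HopfAlgebra.antipode ℂ b)

namespace QuantumDouble

/-! The underlying vector space of the double is `A ⊗ B`; the element `(a, b)` is `a ⊗ₜ b`. -/

/-- For a linear map `T` on `B`, the linear map
`a ⊗ b ↦ ∑ ⟨a₁, T b₃⟩ ⟨a₃, b₁⟩ a₂ ⊗ b₂`. -/
def cross (p : A →ₗ[ℂ] B →ₗ[ℂ] ℂ) (T : B →ₗ[ℂ] B) : A ⊗[ℂ] B →ₗ[ℂ] A ⊗[ℂ] B :=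
  contractOuter (TensorProduct.lift p ∘ₗ TensorProduct.map LinearMap.id T) (TensorProduct.lift p) ∘ₗ
    TensorProduct.map (comul₃ A) (reverse₃ B ∘ₗ comul₃ B)

/-- The Sweedler formula for `cross`. -/
theorem cross_eq_sum (p : A →ₗ[ℂ] B →ₗ[ℂ] ℂ) (T : B →ₗ[ℂ] B) (a : A) (b : B)
    {I J : Type*} (s : Finset I) (t : Finset J) (u v w : I → A) (x y z : J → B)
    (ha : comul₃ A a = ∑ i ∈ s, u i ⊗ₜ[ℂ] (v i ⊗ₜ[ℂ] w i))
    (hb : comul₃ B b = ∑ j ∈ t, x j ⊗ₜ[ℂ] (y j ⊗ₜ[ℂ] z j)) :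
    cross p T (a ⊗ₜ b) =
      ∑ i ∈ s, ∑ j ∈ t, (p (u i) (T (z j)) * p (w i) (x j)) • (v i ⊗ₜ[ℂ] y j) := by
  simp [cross, contractOuter, reverse₃, ha, hb, TensorProduct.sum_tmul, TensorProduct.tmul_sum,
    mul_smul]
  rw [Finset.sum_comm]
  simp only [smul_comm (p (w _) (x _))]

/-- The multiplication of the double:
`(a, b)(a', b') = ∑ (a a'₂, b₂ b') ⟨a'₁, S⁻¹ b₃⟩ ⟨a'₃, b₁⟩`, extended bilinearly. -/
def mul (p : A →ₗ[ℂ] B →ₗ[ℂ] ℂ) : A ⊗[ℂ] B →ₗ[ℂ] A ⊗[ℂ] B →ₗ[ℂ] A ⊗[ℂ] B :=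
  TensorProduct.lift (LinearMap.mk₂ ℂ
    (fun (a : A) (b : B) =>
      TensorProduct.lift (LinearMap.mk₂ ℂ
        (fun (a' : A) (b' : B) =>
          TensorProduct.map (LinearMap.mulLeft ℂ a) (LinearMap.mulRight ℂ b')
            (cross p (antipodeInv B) (a' ⊗ₜ b)))
        (by intros; simp [TensorProduct.add_tmul])
        (by intros; simp [← TensorProduct.smul_tmul'])
        (by
          intro a' b₁ b₂
          rw [← LinearMap.add_apply, ← TensorProduct.map_add_right]
          congr 2; ext; simp [mul_add])
        (by
          intro c a' b'
          rw [← LinearMap.smul_apply, ← TensorProduct.map_smul_right]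
          congr 2; ext; simp)))
    (by
      intro a₁ a₂ b
      ext a' b'
      have h : LinearMap.mulLeft ℂ (a₁ + a₂) = LinearMap.mulLeft ℂ a₁ + LinearMap.mulLeft ℂ a₂ := by
        ext; simp [add_mul]
      simp [h, TensorProduct.map_add_left])
    (by
      intro c a b
      ext a' b'
      have h : LinearMap.mulLeft ℂ (c • a) = c • LinearMap.mulLeft ℂ a := by
        ext; simp
      simp [h, TensorProduct.map_smul_left])
    (by intros; ext; simp [TensorProduct.tmul_add])
    (by intros; ext; simp))

theorem mul_tmul (p : A →ₗ[ℂ] B →ₗ[ℂ] ℂ) (a a' : A) (b b' : B) :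
    mul p (a ⊗ₜ b) (a' ⊗ₜ b') =
      TensorProduct.map (LinearMap.mulLeft ℂ a) (LinearMap.mulRight ℂ b')
        (cross p (antipodeInv B) (a' ⊗ₜ b)) := by
  simp [mul]

/-- The involution of the double, the antilinear extension of
`(a, b)* = ∑ ((a*)₂, (b*)₂) ⟨(a*)₁, S⁻¹((b*)₃)⟩ ⟨(a*)₃, (b*)₁⟩`;
here `S⁻¹((b*)₃) = (S b₃)*` because `Δ` preserves the involution. -/
def involution (p : A →ₗ[ℂ] B →ₗ[ℂ] ℂ) (x : A ⊗[ℂ] B) : A ⊗[ℂ] B :=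
  cross p (antipodeInv B) (star x)

theorem involution_tmul (p : A →ₗ[ℂ] B →ₗ[ℂ] ℂ) (a : A) (b : B) :
    involution p (a ⊗ₜ b) = cross p (antipodeInv B) (star a ⊗ₜ star b) := by
  simp [involution]

/-- `Δ(a, b) = ∑ (a₁, b₁) ⊗ (a₂, b₂)`. -/
def comul (A B : Type*) [Ring A] [HopfAlgebra ℂ A] [Ring B] [HopfAlgebra ℂ B] :
    A ⊗[ℂ] B →ₗ[ℂ] (A ⊗[ℂ] B) ⊗[ℂ] (A ⊗[ℂ] B) :=
  (TensorProduct.tensorTensorTensorComm ℂ A A B B).toLinearMap ∘ₗ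
    TensorProduct.map Coalgebra.comul Coalgebra.comul

/-- `Δ(a, b) = ∑ (a₂, b₁) ⊗ (a₁, b₂)`. -/
def comulCop (A B : Type*) [Ring A] [HopfAlgebra ℂ A] [Ring B] [HopfAlgebra ℂ B] :
    A ⊗[ℂ] B →ₗ[ℂ] (A ⊗[ℂ] B) ⊗[ℂ] (A ⊗[ℂ] B) :=
  (TensorProduct.tensorTensorTensorComm ℂ A A B B).toLinearMap ∘ₗ
    TensorProduct.map ((TensorProduct.comm ℂ A A).toLinearMap ∘ₗ Coalgebra.comul) Coalgebra.comul

/-- `S(a, b) = ∑ (S a₂, S b₂) ⟨a₁, S b₃⟩ ⟨a₃, b₁⟩`. -/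
def antipode (p : A →ₗ[ℂ] B →ₗ[ℂ] ℂ) : A ⊗[ℂ] B →ₗ[ℂ] A ⊗[ℂ] B :=
  TensorProduct.map (HopfAlgebra.antipode ℂ) (HopfAlgebra.antipode ℂ) ∘ₗ
    cross p (HopfAlgebra.antipode ℂ)

/-- `S(a, b) = (1, S b)(S a, 1)`. -/
def antipodeRev (p : A →ₗ[ℂ] B →ₗ[ℂ] ℂ) : A ⊗[ℂ] B →ₗ[ℂ] A ⊗[ℂ] B :=
  TensorProduct.lift (LinearMap.compl₁₂ (mul p).flip
    ((TensorProduct.mk ℂ A B).flip 1 ∘ₗ HopfAlgebra.antipode ℂ)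
    (TensorProduct.mk ℂ A B 1 ∘ₗ HopfAlgebra.antipode ℂ))

theorem antipodeRev_tmul (p : A →ₗ[ℂ] B →ₗ[ℂ] ℂ) (a : A) (b : B) :
    antipodeRev p (a ⊗ₜ b) =
      mul p (1 ⊗ₜ HopfAlgebra.antipode ℂ b) (HopfAlgebra.antipode ℂ a ⊗ₜ 1) := by
  simp [antipodeRev]

/-- The functional `θ` on the double, the linear extension of `θ(a, b) = φ_A(a) φ_B(b)`. -/
def theta (φA : A →ₗ[ℂ] ℂ) (φB : B →ₗ[ℂ] ℂ) : A ⊗[ℂ] B →ₗ[ℂ] ℂ :=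
  TensorProduct.lift ((LinearMap.mul ℂ ℂ).compl₁₂ φA φB)

/-- The canonical embedding `a ↦ (a, 1)`. -/
def inclA (a : A) : A ⊗[ℂ] B := a ⊗ₜ 1

/-- The canonical embedding `b ↦ (1, b)`. -/
def inclB (b : B) : A ⊗[ℂ] B := 1 ⊗ₜ b

/-- The norm `x ↦ θ(x x*)^{1/2}` on the double. -/
def norm (p : A →ₗ[ℂ] B →ₗ[ℂ] ℂ) (φA : A →ₗ[ℂ] ℂ) (φB : B →ₗ[ℂ] ℂ) (x : A ⊗[ℂ] B) : ℝ :=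
  √(theta φA φB (mul p x (involution p x))).re

/-- The norm of the GNS Hilbert space of `θ`, whose inner product is `⟨x, y⟩ = θ(y* x)`. -/
def gnsNorm (p : A →ₗ[ℂ] B →ₗ[ℂ] ℂ) (φA : A →ₗ[ℂ] ℂ) (φB : B →ₗ[ℂ] ℂ) (x : A ⊗[ℂ] B) : ℝ :=
  √(theta φA φB (mul p (involution p x) x)).re

/-- The C*-norm of the double: the operator norm of the left multiplication `y ↦ x y` on the GNS
Hilbert space of `θ`. -/
def cstarNorm (p : A →ₗ[ℂ] B →ₗ[ℂ] ℂ) (φA : A →ₗ[ℂ] ℂ) (φB : B →ₗ[ℂ] ℂ) (x : A ⊗[ℂ] B) : ℝ :=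
  sInf {C : ℝ | 0 ≤ C ∧ ∀ y : A ⊗[ℂ] B, gnsNorm p φA φB (mul p x y) ≤ C * gnsNorm p φA φB y}

end QuantumDouble

end Double

end

/-!
Write `R(a ⊗ b) = (1, b)(a, 1)`, so that the double is `A ⊗ B` with
`(a, b)(a', b') = (a ⊗ 1) R(a' ⊗ b) (1 ⊗ b')` and `x* = R(x⋆)`, where `⋆` is the involution of the
tensor product `A ⊗ B`.

* The double is a unital `*`-algebra. Left multiplication by `(1, b)` is `∑ λ(b₁) L(b₂) ρ(b₃)` for
  three representations of `B` with commuting images, hence multiplicative in `b`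
  (`mul_inclB_mul`); right multiplication by `(a, 1)` is treated in the same way
  (`mul_mul_inclA`), and both together give associativity (`mul_associative`). The map `R` is a
  product of two commuting twists, each of which is inverted by its conjugate under `⋆` because
  `∑ S⁻¹(b₂) b₁ = ε(b)`; this is `involution_involution`.

* The invariant integral `φ` of a finite Hopf C*-algebra is positive and faithful. Convolution by a
  suitable state `ω` has no nonzero fixed vector in the kernel of `φ`, so the Cesàro means of the
  convolution powers of `ω`, which are states, converge to `φ`
  (`IsInvariantIntegral.isPositiveFunctional`). If `φ(a* a) = 0`, then
  `(φ ⊗ ι)(Δ(a)* Δ(a)) = 0`, which forces `φ(c a₁) a₂ = 0` for all `c`, and then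
  `a = ∑ φ(S⁻¹(a₂) a₁) a₃ = 0` (`IsInvariantIntegral.apply_star_mul_self_pos`).

* Invariance of `φ_B` gives `θ(R(x)) = θ(x)`, and more generally `θ(x y*) = (φ_A ⊗ φ_B)(x y⋆)`
  (`theta_mul_involution`). The right side is a positive definite form, since `φ_A` and `φ_B` are
  faithful and positive. As `x ↦ x*` is an involution, `θ(x* x)` is positive as well. No trace
  property of `θ` is needed.

* For the C*-norms, `‖c‖² - c* c = d* d` shows that left multiplication by `c` is bounded by `‖c‖`
  on the GNS space, and an eigenvector of `c* c` for the eigenvalue `‖c‖²`, available in finite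
  dimension, shows that the bound is attained (`cstarNorm_eq_norm`).
-/

open CStarAlgebra

/-! ### Finite-dimensional C*-algebras and positive functionals -/

/-- A functional on a `*`-algebra is positive if it is nonnegative on all `a* a`. -/
def IsPositiveFunctional {A : Type*} [Ring A] [StarRing A] [Module ℂ A] (ω : A →ₗ[ℂ] ℂ) : Prop :=
  ∀ a : A, 0 ≤ ω (star a * a)

namespace CStarAlgebra

variable {A : Type*} [CStarAlgebra A]

theorem exists_norm_sq_sub_star_mul_self (a : A) :
    ∃ c : A, ((‖a‖ ^ 2 : ℝ) : ℂ) • (1 : A) - star a * a = star c * c := by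
  let _ := CStarAlgebra.spectralOrder A
  have := CStarAlgebra.spectralOrderedRing A
  have h : (0 : A) ≤ algebraMap ℝ A (‖a‖ ^ 2) - star a * a :=
    sub_nonneg.2 CStarAlgebra.star_mul_le_algebraMap_norm_sq
  obtain ⟨c, hc⟩ := CStarAlgebra.nonneg_iff_eq_star_mul_self.1 h
  refine ⟨c, ?_⟩
  rw [← hc, Algebra.algebraMap_eq_smul_one, Complex.coe_smul]

theorem eq_zero_of_sum_star_mul_self_eq_zero {ι : Type*} [Fintype ι] (z : ι → A)
    (h : ∑ k, star (z k) * z k = 0) (k : ι) : z k = 0 := by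
  let _ := CStarAlgebra.spectralOrder A
  have := CStarAlgebra.spectralOrderedRing A
  have := (Finset.sum_eq_zero_iff_of_nonneg (fun i _ => star_mul_self_nonneg (z i))).1 h k
    (Finset.mem_univ k)
  exact CStarRing.star_mul_self_eq_zero_iff _ |>.1 this

/-- The Cauchy–Schwarz inequality for the form `(x, y) ↦ ω(x* y)`. -/
theorem norm_apply_sq_le {ω : A →ₗ[ℂ] ℂ} (hω : IsPositiveFunctional ω) (x y : A) :
    ‖ω (star x * y)‖ ^ 2 ≤ (ω (star x * x)).re * (ω (star y * y)).re := by
  let _ := CStarAlgebra.spectralOrder A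
  have := CStarAlgebra.spectralOrderedRing A
  let f : A →ₚ[ℂ] ℂ := PositiveLinearMap.mk₀ ω (by
    intro a ha
    obtain ⟨c, rfl⟩ := CStarAlgebra.nonneg_iff_eq_star_mul_self.1 ha
    exact hω c)
  have h := norm_inner_le_norm (𝕜 := ℂ) (f.toPreGNS x) (f.toPreGNS y)
  have hx := hω x
  have hy := hω y
  have h1 : ‖ω (star x * y)‖ ≤ √(ω (star x * x)).re * √(ω (star y * y)).re := h
  calc ‖ω (star x * y)‖ ^ 2 ≤ (√(ω (star x * x)).re * √(ω (star y * y)).re) ^ 2 := by gcongr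
    _ = _ := by
      rw [mul_pow, Real.sq_sqrt (Complex.nonneg_iff.1 hx).1, Real.sq_sqrt (Complex.nonneg_iff.1 hy).1]

theorem norm_apply_le_of_apply_one {ω : A →ₗ[ℂ] ℂ} (hω : IsPositiveFunctional ω) (h1 : ω 1 = 1)
    (y : A) : ‖ω y‖ ≤ ‖y‖ := by
  have h := norm_apply_sq_le hω 1 y
  obtain ⟨c, hc⟩ := exists_norm_sq_sub_star_mul_self y
  have h2 : 0 ≤ ((‖y‖ ^ 2 : ℝ) : ℂ) - ω (star y * y) := by
    have := hω c
    rw [← hc, map_sub, map_smul, h1, smul_eq_mul, mul_one] at this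
    exact this
  have h3 : (ω (star y * y)).re ≤ ‖y‖ ^ 2 := by
    have := (Complex.nonneg_iff.1 h2).1
    rw [Complex.sub_re, Complex.ofReal_re] at this
    linarith
  simp only [star_one, one_mul, h1, Complex.one_re] at h
  exact abs_le_of_sq_le_sq' (h.trans h3) (norm_nonneg _) |>.2

/-- An element of a finite-dimensional algebra that annihilates nothing from the left is a unit. -/
theorem isUnit_of_mul_eq_zero_imp [FiniteDimensional ℂ A] (z : A)
    (h : ∀ x, z * x = 0 → x = 0) : IsUnit z := by
  have hinj : Function.Injective (LinearMap.mulLeft ℂ z) := by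
    rw [← LinearMap.ker_eq_bot, LinearMap.ker_eq_bot']
    exact h
  obtain ⟨y, hy⟩ := LinearMap.injective_iff_surjective.1 hinj 1
  rw [LinearMap.mulLeft_apply] at hy
  have h2 : y * z = 1 := by
    have := h (y * z - 1) (by rw [mul_sub, ← mul_assoc, hy]; simp)
    exact sub_eq_zero.1 this
  exact ⟨⟨z, y, hy, h2⟩, rfl⟩

/-- In finite dimension the norm of `c* c` is an eigenvalue of the left multiplication by `c* c`. -/
theorem exists_star_mul_self_mul_eq [FiniteDimensional ℂ A] [Nontrivial A] (c : A) :
    ∃ x : A, x ≠ 0 ∧ star c * c * x = ((‖c‖ ^ 2 : ℝ) : ℂ) • x := by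
  let _ := CStarAlgebra.spectralOrder A
  have := CStarAlgebra.spectralOrderedRing A
  by_contra! hcon
  have h := CStarAlgebra.norm_mem_spectrum_of_nonneg (star_mul_self_nonneg c)
  refine h (isUnit_of_mul_eq_zero_imp _ fun x hx => ?_)
  by_contra hx0
  refine hcon x hx0 ?_
  rw [sub_mul, sub_eq_zero, Algebra.algebraMap_eq_smul_one, smul_one_mul,
    CStarRing.norm_star_mul_self, ← pow_two] at hx
  rw [← hx, Complex.coe_smul]

/-- The trace of the left multiplication by `c* c` is the sum of its eigenvalues, which are
nonnegative and include `‖c‖²`. -/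
theorem norm_sq_le_trace_mulLeft [FiniteDimensional ℂ A] [Nontrivial A] (c : A) :
    ((‖c‖ ^ 2 : ℝ) : ℂ) ≤ LinearMap.trace ℂ A (LinearMap.mulLeft ℂ (star c * c)) := by
  let _ := CStarAlgebra.spectralOrder A
  have := CStarAlgebra.spectralOrderedRing A
  rw [Module.End.trace_eq_sum_roots_charpoly_of_splits (IsAlgClosed.splits _)]
  have hnn : ∀ μ ∈ (LinearMap.mulLeft ℂ (star c * c)).charpoly.roots, 0 ≤ μ := by
    intro μ hμ
    have hr := Polynomial.isRoot_of_mem_roots hμ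
    rw [← Module.End.hasEigenvalue_iff_isRoot_charpoly] at hr
    obtain ⟨x, hx⟩ := hr.exists_hasEigenvector
    refine spectrum_nonneg_of_nonneg (star_mul_self_nonneg c) (x := μ) fun hu => hx.2 ?_
    have h1 := hx.apply_eq_smul
    rw [LinearMap.mulLeft_apply] at h1
    refine (hu.mul_right_eq_zero).1 ?_
    rw [sub_mul, h1, Algebra.algebraMap_eq_smul_one, smul_one_mul, sub_self]
  refine Multiset.single_le_sum hnn _ ?_
  obtain ⟨x, hx0, hx⟩ := exists_star_mul_self_mul_eq c
  rw [Polynomial.mem_roots (LinearMap.charpoly_monic _).ne_zero,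
    ← Module.End.hasEigenvalue_iff_isRoot_charpoly]
  exact Module.End.hasEigenvalue_of_hasEigenvector (x := x)
    (Module.End.hasEigenvector_iff.2 ⟨Module.End.mem_eigenspace_iff.2 hx, hx0⟩)

end CStarAlgebra

/-- Applying a positive functional `ω` to the first leg of `t* t` gives a sum of elements `z* z`;
if these vanish, then `ω` kills all `x* x` with `x` a first leg of `t`. -/
theorem exists_map_star_mul_self_eq_sum {A B ι : Type*} [CStarAlgebra A] [CStarAlgebra B]
    [Fintype ι] {ω : A →ₗ[ℂ] ℂ} (hω : IsPositiveFunctional ω) (x : ι → A) (v : ι → B) :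
    ∃ (m : ℕ) (z : Fin m → B),
      TensorProduct.lid ℂ B (TensorProduct.map ω LinearMap.id
        (star (∑ i, x i ⊗ₜ[ℂ] v i) * ∑ i, x i ⊗ₜ[ℂ] v i)) = ∑ k, star (z k) * z k ∧
      (LinearIndependent ℂ v → (∀ k, z k = 0) → ∀ i, ω (star (x i) * x i) = 0) := by
  classical
  let _ := CStarAlgebra.spectralOrder A
  have := CStarAlgebra.spectralOrderedRing A
  let f : A →ₚ[ℂ] ℂ := PositiveLinearMap.mk₀ ω (by
    intro a ha
    obtain ⟨c, rfl⟩ := CStarAlgebra.nonneg_iff_eq_star_mul_self.1 ha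
    exact hω c)
  have hstar : ∀ a, ω (star a) = star (ω a) := fun a => map_star f a
  let M : Matrix ι ι ℂ := Matrix.of fun i j => ω (star (x i) * x j)
  have hM : M.PosSemidef := by
    refine Matrix.PosSemidef.of_dotProduct_mulVec_nonneg ?_ fun c => ?_
    · ext i j
      simp [M, ← hstar]
    · have := hω (∑ i, c i • x i)
      simp only [star_sum, star_smul, Finset.sum_mul, Finset.mul_sum, smul_mul_assoc,
        mul_smul_comm, map_sum, map_smul, smul_eq_mul] at this
      rw [Finset.sum_comm] at this
      simp only [dotProduct, Matrix.mulVec, M, Matrix.of_apply, Finset.mul_sum, Pi.star_apply]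
      exact this.trans_eq (Finset.sum_congr rfl fun i _ => Finset.sum_congr rfl fun j _ => by ring)
  obtain ⟨m, N, hN⟩ := Matrix.posSemidef_iff_eq_sum_vecMulVec.1 hM
  have hMN : ∀ i j, ω (star (x i) * x j) = ∑ k, N k i * star (N k j) := by
    intro i j
    have := congrFun (congrFun hN i) j
    simpa [M, Matrix.sum_apply, Matrix.vecMulVec_apply] using this
  refine ⟨m, fun k => ∑ i, star (N k i) • v i, ?_, ?_⟩
  · simp only [star_sum, TensorProduct.star_tmul, Finset.sum_mul, Finset.mul_sum,
      Algebra.TensorProduct.tmul_mul_tmul, map_sum, TensorProduct.map_tmul, LinearMap.id_apply,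
      TensorProduct.lid_tmul, hMN, Finset.sum_smul, star_smul, smul_mul_assoc, mul_smul_comm,
      star_star]
    rw [Finset.sum_congr rfl fun j _ => Finset.sum_comm, Finset.sum_comm]
    simp only [Finset.smul_sum, smul_smul, mul_comm]
  · intro hv hz i
    have hN0 : ∀ k i, N k i = 0 := fun k i => by
      simpa using (Fintype.linearIndependent_iff.1 hv) (fun i => star (N k i)) (hz k) i
    simp [hMN, hN0]

/-! ### Slices of the comultiplication -/

section Slices

variable {C : Type*} [AddCommGroup C] [Module ℂ C] [Coalgebra ℂ C]

/-- The map `c ↦ ∑ f(c₁) c₂`. -/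
noncomputable def leftSlice (f : C →ₗ[ℂ] ℂ) : C →ₗ[ℂ] C :=
  (TensorProduct.lid ℂ C).toLinearMap ∘ₗ TensorProduct.map f LinearMap.id ∘ₗ Coalgebra.comul

/-- The map `c ↦ ∑ c₁ g(c₂)`. -/
noncomputable def rightSlice (g : C →ₗ[ℂ] ℂ) : C →ₗ[ℂ] C :=
  (TensorProduct.rid ℂ C).toLinearMap ∘ₗ TensorProduct.map LinearMap.id g ∘ₗ Coalgebra.comul

/-- The product `(f ⋆ g)(c) = ∑ f(c₁) g(c₂)` of functionals. -/
noncomputable def convolve (f g : C →ₗ[ℂ] ℂ) : C →ₗ[ℂ] ℂ :=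
  LinearMap.mul' ℂ ℂ ∘ₗ TensorProduct.map f g ∘ₗ Coalgebra.comul

theorem leftSlice_add (f g : C →ₗ[ℂ] ℂ) : leftSlice (f + g) = leftSlice f + leftSlice g := by
  rw [leftSlice, TensorProduct.map_add_left, LinearMap.add_comp, LinearMap.comp_add]
  rfl

theorem leftSlice_smul (r : ℂ) (f : C →ₗ[ℂ] ℂ) : leftSlice (r • f) = r • leftSlice f := by
  rw [leftSlice, TensorProduct.map_smul_left, LinearMap.smul_comp, LinearMap.comp_smul]
  rfl

theorem apply_leftSlice (f g : C →ₗ[ℂ] ℂ) (c : C) : g (leftSlice f c) = convolve f g c := by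
  simp only [leftSlice, convolve, LinearMap.comp_apply, LinearEquiv.coe_coe]
  induction Coalgebra.comul (R := ℂ) c with
  | zero => simp
  | tmul x y => simp
  | add x y hx hy => simp only [map_add, hx, hy]

theorem apply_rightSlice (f g : C →ₗ[ℂ] ℂ) (c : C) : f (rightSlice g c) = convolve f g c := by
  simp only [rightSlice, convolve, LinearMap.comp_apply, LinearEquiv.coe_coe]
  induction Coalgebra.comul (R := ℂ) c with
  | zero => simp
  | tmul x y => simp [mul_comm]
  | add x y hx hy => simp only [map_add, hx, hy]

theorem leftSlice_counit : leftSlice (Coalgebra.counit (R := ℂ) (A := C)) = LinearMap.id := by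
  ext c
  have := Coalgebra.rTensor_counit_comul (R := ℂ) c
  simp only [LinearMap.rTensor] at this
  simp [leftSlice, this]

theorem rightSlice_counit : rightSlice (Coalgebra.counit (R := ℂ) (A := C)) = LinearMap.id := by
  ext c
  have := Coalgebra.lTensor_counit_comul (R := ℂ) c
  simp only [LinearMap.lTensor] at this
  simp [rightSlice, this]

/-- Two linear maps out of `C ⊗ (C ⊗ C)`, `(C ⊗ C) ⊗ C` that match under the associator agree on
the two threefold coproducts. -/
theorem map_comul_coassoc {X : Type*} [AddCommGroup X] [Module ℂ X]
    (F : (C ⊗[ℂ] C) ⊗[ℂ] C →ₗ[ℂ] X) (G : C ⊗[ℂ] (C ⊗[ℂ] C) →ₗ[ℂ] X)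
    (h : ∀ x y z : C, F ((x ⊗ₜ y) ⊗ₜ z) = G (x ⊗ₜ (y ⊗ₜ z))) (c : C) :
    F (TensorProduct.map Coalgebra.comul LinearMap.id (Coalgebra.comul (R := ℂ) c)) =
      G (TensorProduct.map LinearMap.id Coalgebra.comul (Coalgebra.comul (R := ℂ) c)) := by
  have h1 : F = G ∘ₗ (TensorProduct.assoc ℂ C C C).toLinearMap := by
    ext x y z
    exact h x y z
  have h2 := Coalgebra.coassoc_apply (R := ℂ) c
  simp only [LinearMap.rTensor, LinearMap.lTensor] at h2
  rw [h1, LinearMap.comp_apply, LinearEquiv.coe_coe, h2]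

theorem leftSlice_rightSlice (f g : C →ₗ[ℂ] ℂ) (c : C) :
    leftSlice f (rightSlice g c) = rightSlice g (leftSlice f c) := by
  have h := map_comul_coassoc
    ((TensorProduct.rid ℂ C).toLinearMap ∘ₗ TensorProduct.map
      ((TensorProduct.lid ℂ C).toLinearMap ∘ₗ TensorProduct.map f LinearMap.id) g)
    ((TensorProduct.lid ℂ C).toLinearMap ∘ₗ TensorProduct.map f
      ((TensorProduct.rid ℂ C).toLinearMap ∘ₗ TensorProduct.map LinearMap.id g))
    (by intro x y z; simp [smul_smul, mul_comm]) c
  convert h using 1 <;>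
  · simp only [leftSlice, rightSlice, LinearMap.comp_apply, LinearEquiv.coe_coe]
    induction Coalgebra.comul (R := ℂ) c with
    | zero => simp
    | tmul x y => simp
    | add x y hx hy => simp only [map_add, hx, hy]

theorem leftSlice_leftSlice (f g : C →ₗ[ℂ] ℂ) (c : C) :
    leftSlice f (leftSlice g c) = leftSlice (convolve g f) c := by
  have h := map_comul_coassoc
    ((TensorProduct.lid ℂ C).toLinearMap ∘ₗ TensorProduct.map
      (LinearMap.mul' ℂ ℂ ∘ₗ TensorProduct.map g f) LinearMap.id)
    ((TensorProduct.lid ℂ C).toLinearMap ∘ₗ TensorProduct.map g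
      ((TensorProduct.lid ℂ C).toLinearMap ∘ₗ TensorProduct.map f LinearMap.id))
    (by intro x y z; simp [smul_smul, mul_comm (f y)]) c
  symm
  convert h using 1 <;>
  · simp only [leftSlice, convolve, LinearMap.comp_apply, LinearEquiv.coe_coe]
    induction Coalgebra.comul (R := ℂ) c with
    | zero => simp
    | tmul x y => simp
    | add x y hx hy => simp only [map_add, hx, hy]

theorem rightSlice_rightSlice (f g : C →ₗ[ℂ] ℂ) (c : C) :
    rightSlice f (rightSlice g c) = rightSlice (convolve f g) c := by
  have h := map_comul_coassoc
    ((TensorProduct.rid ℂ C).toLinearMap ∘ₗ TensorProduct.map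
      ((TensorProduct.rid ℂ C).toLinearMap ∘ₗ TensorProduct.map LinearMap.id f) g)
    ((TensorProduct.rid ℂ C).toLinearMap ∘ₗ TensorProduct.map LinearMap.id
      (LinearMap.mul' ℂ ℂ ∘ₗ TensorProduct.map f g))
    (by intro x y z; simp [smul_smul, mul_comm]) c
  convert h using 1 <;>
  · simp only [rightSlice, convolve, LinearMap.comp_apply, LinearEquiv.coe_coe]
    induction Coalgebra.comul (R := ℂ) c with
    | zero => simp
    | tmul x y => simp
    | add x y hx hy => simp only [map_add, hx, hy]

end Slices

/-! ### Positivity and faithfulness of the invariant integral -/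

section Integral

variable {A : Type*} [NormedRing A] [StarRing A] [HopfAlgebra ℂ A] [FiniteHopfCStar A]

/-- The C*-algebra underlying a finite Hopf C*-algebra. -/
@[reducible]
noncomputable def FiniteHopfCStar.cstarAlgebra (A : Type*) [NormedRing A] [StarRing A]
    [HopfAlgebra ℂ A] [FiniteHopfCStar A] : CStarAlgebra A :=
  letI : NormedAlgebra ℂ A :=
    { (inferInstance : Algebra ℂ A) with norm_smul_le := fun c a => (norm_smul c a).le }
  haveI : CompleteSpace A := FiniteDimensional.complete ℂ A
  { }

theorem FiniteHopfCStar.nontrivial (A : Type*) [NormedRing A] [StarRing A]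
    [HopfAlgebra ℂ A] [FiniteHopfCStar A] : Nontrivial A := by
  refine ⟨1, 0, fun h => ?_⟩
  have := Bialgebra.counit_one (R := ℂ) (A := A)
  rw [h, map_zero] at this
  exact zero_ne_one this

theorem isPositiveFunctional_counit :
    IsPositiveFunctional (Coalgebra.counit (R := ℂ) (A := A)) := by
  intro a
  rw [Bialgebra.counit_mul, FiniteHopfCStar.counit_star]
  exact star_mul_self_nonneg _

theorem exists_eq_sum_tmul_basis {V W ι : Type*} [AddCommGroup V] [Module ℂ V] [AddCommGroup W]
    [Module ℂ W] [Fintype ι] (v : Module.Basis ι ℂ W) (t : V ⊗[ℂ] W) :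
    ∃ x : ι → V, t = ∑ i, x i ⊗ₜ[ℂ] v i := by
  induction t with
  | zero => exact ⟨0, by simp⟩
  | tmul a b =>
    refine ⟨fun i => v.repr b i • a, ?_⟩
    simp only [TensorProduct.smul_tmul, ← TensorProduct.tmul_sum, v.sum_repr]
  | add s t hs ht =>
    obtain ⟨x, rfl⟩ := hs
    obtain ⟨y, rfl⟩ := ht
    exact ⟨x + y, by simp [TensorProduct.add_tmul, Finset.sum_add_distrib]⟩

theorem comul_star_mul_self (a : A) : Coalgebra.comul (R := ℂ) (star a * a) =
    star (Coalgebra.comul (R := ℂ) a) * Coalgebra.comul (R := ℂ) a := by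
  rw [Bialgebra.comul_mul, FiniteHopfCStar.comul_star]

/-- `(f ⋆ g)(a* a) = (f ⊗ g)(Δ(a)* Δ(a))`, and applying `f` to the first leg leaves a sum of
elements `z* z`. -/
theorem isPositiveFunctional_convolve {f g : A →ₗ[ℂ] ℂ} (hf : IsPositiveFunctional f)
    (hg : IsPositiveFunctional g) : IsPositiveFunctional (convolve f g) := by
  let _ := FiniteHopfCStar.cstarAlgebra A
  intro a
  obtain ⟨x, hx⟩ := exists_eq_sum_tmul_basis (Module.finBasis ℂ A) (Coalgebra.comul (R := ℂ) a)
  obtain ⟨m, z, hz, -⟩ := exists_map_star_mul_self_eq_sum hf x (Module.finBasis ℂ A)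
  rw [← hx, ← comul_star_mul_self] at hz
  rw [← apply_leftSlice]
  change 0 ≤ g (TensorProduct.lid ℂ A (TensorProduct.map f LinearMap.id _))
  rw [hz, map_sum]
  exact Finset.sum_nonneg fun k _ => hg (z k)

/-- The functional `a ↦ conj f(a*)`. -/
noncomputable def starFunctional (f : A →ₗ[ℂ] ℂ) : A →ₗ[ℂ] ℂ where
  toFun a := conj (f (star a))
  map_add' x y := by simp
  map_smul' c x := by simp

theorem starFunctional_apply (f : A →ₗ[ℂ] ℂ) (a : A) : starFunctional f a = conj (f (star a)) := rfl

theorem star_rightSlice_star (f : A →ₗ[ℂ] ℂ) (a : A) :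
    star (rightSlice f (star a)) = rightSlice (starFunctional f) a := by
  simp only [rightSlice, LinearMap.comp_apply, LinearEquiv.coe_coe, FiniteHopfCStar.comul_star]
  induction Coalgebra.comul (R := ℂ) a with
  | zero => simp
  | tmul x y => simp [starFunctional_apply]
  | add x y hx hy => simp only [map_add, star_add, hx, hy]

theorem star_leftSlice_star (f : A →ₗ[ℂ] ℂ) (a : A) :
    star (leftSlice f (star a)) = leftSlice (starFunctional f) a := by
  simp only [leftSlice, LinearMap.comp_apply, LinearEquiv.coe_coe, FiniteHopfCStar.comul_star]
  induction Coalgebra.comul (R := ℂ) a with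
  | zero => simp
  | tmul x y => simp [starFunctional_apply]
  | add x y hx hy => simp only [map_add, star_add, hx, hy]

theorem leftSlice_one (f : A →ₗ[ℂ] ℂ) : leftSlice f 1 = f 1 • (1 : A) := by
  simp [leftSlice, Algebra.TensorProduct.one_def]

theorem rightSlice_one (f : A →ₗ[ℂ] ℂ) : rightSlice f 1 = f 1 • (1 : A) := by
  simp [rightSlice, Algebra.TensorProduct.one_def]

theorem antipodeInv_mul (x y : A) : antipodeInv A (x * y) = antipodeInv A y * antipodeInv A x := by
  change star _ = star _ * star _
  rw [star_mul, FiniteHopfCStar.antipode_mul_rev, star_mul]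

theorem antipodeInv_one : antipodeInv A 1 = 1 := by
  change star _ = _
  simp

/-- `∑ S⁻¹(a₂) a₁ = ε(a) 1`. -/
theorem antipodeInv_mul_comul (a : A) :
    LinearMap.mul' ℂ A (TensorProduct.map (antipodeInv A) LinearMap.id
      (TensorProduct.comm ℂ A A (Coalgebra.comul (R := ℂ) a))) =
      Coalgebra.counit (R := ℂ) a • (1 : A) := by
  have h := congrArg (antipodeInv A) (HopfAlgebra.mul_antipode_rTensor_comul_apply (R := ℂ) a)
  rw [Algebra.algebraMap_eq_smul_one, map_smul, antipodeInv_one] at h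
  rw [← h]
  induction Coalgebra.comul (R := ℂ) a with
  | zero => simp
  | tmul x y => simp [antipodeInv_mul, antipodeInv_antipode]
  | add x y hx hy => simp only [map_add, hx, hy]

theorem IsInvariantIntegral.leftSlice_eq {φ : A →ₗ[ℂ] ℂ}
    (hφ : IsInvariantIntegral Coalgebra.comul 1 (HopfAlgebra.antipode ℂ) φ) (a : A) :
    leftSlice φ a = φ a • (1 : A) := hφ.left_inv a

theorem IsInvariantIntegral.rightSlice_eq {φ : A →ₗ[ℂ] ℂ}
    (hφ : IsInvariantIntegral Coalgebra.comul 1 (HopfAlgebra.antipode ℂ) φ) (a : A) :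
    rightSlice φ a = φ a • (1 : A) := hφ.right_inv a

/-- The functional `a ↦ conj φ(a*)` is invariant too, and hence equal to `φ` by uniqueness. -/
theorem IsInvariantIntegral.apply_star {φ : A →ₗ[ℂ] ℂ}
    (hφ : IsInvariantIntegral Coalgebra.comul 1 (HopfAlgebra.antipode ℂ) φ) (hφ1 : φ 1 = 1)
    (a : A) : φ (star a) = conj (φ a) := by
  have h1 : starFunctional φ 1 = 1 := by simp [starFunctional_apply, hφ1]
  have h2 : rightSlice (starFunctional φ) a = starFunctional φ a • (1 : A) := by
    rw [← star_rightSlice_star, hφ.rightSlice_eq, star_smul, star_one]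
    rfl
  have h3 : starFunctional φ a = φ a := by
    have h4 := apply_leftSlice φ (starFunctional φ) a
    rw [← apply_rightSlice, h2, hφ.leftSlice_eq, map_smul, map_smul, h1, hφ1] at h4
    simpa using h4.symm
  rw [← h3, starFunctional_apply, Complex.conj_conj]

/-- A linear combination of the trace of the regular representation, the counit and `φ` that is a
state `ω` for which convolution by `ω` fixes no nonzero element of the kernel of `φ`. The
multiple of `ε - φ` shifts the convolution operator on the kernel of `φ` by a scalar, and is small
enough for positivity because the trace dominates the norm. -/
theorem IsInvariantIntegral.exists_state {φ : A →ₗ[ℂ] ℂ}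
    (hφ : IsInvariantIntegral Coalgebra.comul 1 (HopfAlgebra.antipode ℂ) φ) (hφ1 : φ 1 = 1) :
    ∃ ω : A →ₗ[ℂ] ℂ, IsPositiveFunctional ω ∧ ω 1 = 1 ∧
      ∀ y, φ y = 0 → leftSlice ω y = y → y = 0 := by
  let _ := FiniteHopfCStar.cstarAlgebra A
  have := FiniteHopfCStar.nontrivial A
  set τ : A →ₗ[ℂ] ℂ := LinearMap.trace ℂ A ∘ₗ LinearMap.mul ℂ A with hτ
  have hn : 0 < (Module.finrank ℂ A : ℝ) := by exact_mod_cast Module.finrank_pos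
  set n : ℝ := (Module.finrank ℂ A : ℝ) with hn'
  have hτ1 : τ 1 = (n : ℂ) := by
    have : LinearMap.mul ℂ A 1 = LinearMap.id := by ext; simp
    simp [hτ, this, hn']
  set K : ℝ := ‖LinearMap.toContinuousLinearMap φ‖ with hK
  have hK0 : 0 ≤ K := norm_nonneg _
  have hφK : ∀ c : A, φ (star c * c) ≤ ((K * ‖c‖ ^ 2 : ℝ) : ℂ) := by
    intro c
    have hreal : conj (φ (star c * c)) = φ (star c * c) := by
      rw [← hφ.apply_star hφ1, star_mul, star_star]
    rw [← Complex.conj_eq_iff_re.1 hreal]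
    refine Complex.real_le_real.2 ?_
    calc (φ (star c * c)).re ≤ ‖φ (star c * c)‖ := Complex.re_le_norm _
      _ ≤ K * ‖star c * c‖ := (LinearMap.toContinuousLinearMap φ).le_opNorm _
      _ = K * ‖c‖ ^ 2 := by rw [CStarRing.norm_star_mul_self, pow_two]
  -- For `0 < t < δ` the term `t φ` is dominated by `τ / n` on elements `c* c`.
  set δ : ℝ := (n * (K + 1))⁻¹ with hδ
  have hδ0 : 0 < δ := by positivity
  set T₀ : Module.End ℂ A := leftSlice ((n⁻¹ : ℂ) • τ) with hT₀
  -- On the kernel of `φ` the operator of `ω` is `T₀ + t`, so `1 - t` must not be an eigenvalue of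
  -- `T₀`, which excludes finitely many `t`.
  have hfin : {t : ℝ | T₀.HasEigenvalue ((1 - t : ℝ) : ℂ)}.Finite := by
    refine Set.Finite.preimage (f := fun t : ℝ => ((1 - t : ℝ) : ℂ)) ?_
      (Module.End.finite_hasEigenvalue T₀)
    intro s _ t _ hst
    have := Complex.ofReal_injective hst
    linarith
  obtain ⟨t, ht, htn⟩ := (Set.Ioo_infinite hδ0).exists_notMem_finite hfin
  have htK : t * K ≤ n⁻¹ := by
    calc t * K ≤ δ * (K + 1) := by
          apply mul_le_mul ht.2.le (by linarith) hK0 hδ0.le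
      _ = n⁻¹ := by rw [hδ]; field_simp
  have hadd : ∀ y, leftSlice ((n⁻¹ : ℂ) • τ + (t : ℂ) • (Coalgebra.counit - φ)) y =
      T₀ y + (t : ℂ) • (y - φ y • (1 : A)) := by
    intro y
    rw [sub_eq_add_neg, ← neg_one_smul ℂ φ, leftSlice_add, leftSlice_smul (t : ℂ), leftSlice_add,
      leftSlice_smul (-1), leftSlice_counit]
    simp [hφ.leftSlice_eq, hT₀, sub_eq_add_neg]
  refine ⟨(n⁻¹ : ℂ) • τ + (t : ℂ) • (Coalgebra.counit - φ), ?_, ?_, ?_⟩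
  · intro c
    have h1 : ((n⁻¹ * ‖c‖ ^ 2 : ℝ) : ℂ) ≤ (n⁻¹ : ℂ) * τ (star c * c) := by
      push_cast
      refine mul_le_mul_of_nonneg_left ?_ ?_
      · exact_mod_cast norm_sq_le_trace_mulLeft c
      · exact_mod_cast inv_nonneg.2 hn.le
    have ht0 : (0 : ℂ) ≤ (t : ℂ) := by exact_mod_cast ht.1.le
    have h2 := mul_nonneg ht0 (isPositiveFunctional_counit (A := A) c)
    have h3 := mul_le_mul_of_nonneg_left (hφK c) ht0
    have h4 : (((t * K) * ‖c‖ ^ 2 : ℝ) : ℂ) ≤ ((n⁻¹ * ‖c‖ ^ 2 : ℝ) : ℂ) := by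
      refine Complex.real_le_real.2 ?_
      gcongr
    have h5 : (t : ℂ) * φ (star c * c) ≤ (n⁻¹ : ℂ) * τ (star c * c) := by
      refine h3.trans (le_trans (le_of_eq ?_) (h4.trans h1))
      push_cast; ring
    simp only [LinearMap.add_apply, LinearMap.smul_apply, LinearMap.sub_apply, smul_eq_mul, mul_sub]
    have h6 := add_nonneg (sub_nonneg.2 h5) h2
    refine h6.trans_eq ?_
    ring
  · have : (n : ℂ) ≠ 0 := by exact_mod_cast hn.ne'
    simp [hτ1, hφ1, this]
  · intro y hy hTy
    by_contra hy0
    refine htn (Module.End.hasEigenvalue_of_hasEigenvector (x := y)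
      (Module.End.hasEigenvector_iff.2 ⟨Module.End.mem_eigenspace_iff.2 ?_, hy0⟩))
    rw [hadd, hy, zero_smul, sub_zero] at hTy
    rw [eq_sub_of_add_eq hTy]
    push_cast
    rw [sub_smul, one_smul]

/-- The Cesàro means of the convolution powers of a state as in
`IsInvariantIntegral.exists_state` converge to `φ`. -/
theorem IsInvariantIntegral.isPositiveFunctional {φ : A →ₗ[ℂ] ℂ}
    (hφ : IsInvariantIntegral Coalgebra.comul 1 (HopfAlgebra.antipode ℂ) φ) (hφ1 : φ 1 = 1) :
    IsPositiveFunctional φ := by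
  let _ := FiniteHopfCStar.cstarAlgebra A
  obtain ⟨ω, hω, hω1, hker⟩ := hφ.exists_state hφ1
  set T : Module.End ℂ A := leftSlice ω with hT
  have hφT : ∀ y, φ (T y) = φ y := fun y => by
    rw [hT, apply_leftSlice, ← apply_rightSlice, hφ.rightSlice_eq, map_smul, hω1, smul_eq_mul,
      mul_one]
  let η : ℕ → A →ₗ[ℂ] ℂ := fun k => Coalgebra.counit ∘ₗ (T ^ k)
  have hη : ∀ k, IsPositiveFunctional (η k) ∧ η k 1 = 1 := by
    intro k
    induction k with
    | zero => exact ⟨isPositiveFunctional_counit, Bialgebra.counit_one⟩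
    | succ k ih =>
      have h1 : ∀ a, η (k + 1) a = η k (T a) := fun a => by simp [η, pow_succ]
      refine ⟨fun c => ?_, ?_⟩
      · rw [h1, hT, apply_leftSlice]
        exact isPositiveFunctional_convolve hω ih.1 c
      · rw [h1, hT, leftSlice_one, hω1, one_smul, ih.2]
  intro c
  set x := star c * c with hx
  -- Up to the multiple `φ(x) 1` of the unit, `x` is a coboundary `y - T y`, so that the sums of
  -- `ε(Tᵏ x)` telescope.
  obtain ⟨y, hy⟩ : ∃ y, y - T y + φ y • (1 : A) = x := by
    let S : A →ₗ[ℂ] A := LinearMap.id - T + LinearMap.smulRight φ (1 : A)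
    have hS : Function.Injective S := by
      rw [← LinearMap.ker_eq_bot, LinearMap.ker_eq_bot']
      intro z hz
      have hz' : z - T z + φ z • (1 : A) = 0 := hz
      have h0 : φ z = 0 := by simpa [hφT, hφ1] using congrArg φ hz'
      rw [h0, zero_smul, add_zero, sub_eq_zero] at hz'
      exact hker z h0 hz'.symm
    exact LinearMap.injective_iff_surjective.1 hS x
  have hφy : φ y = φ x := by simp [← hy, hφT, hφ1]
  have hstep : ∀ k, η k x = η k y - η (k + 1) y + φ x := by
    intro k
    have h1 : η (k + 1) y = η k (T y) := by simp [η, pow_succ]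
    rw [h1, ← hφy, ← map_sub, ← hy, map_add, map_smul, (hη k).2, smul_eq_mul, mul_one]
  have hsum : ∀ N : ℕ, ∑ k ∈ Finset.range N, η k x = η 0 y - η N y + N * φ x := by
    intro N
    rw [Finset.sum_congr rfl fun k _ => hstep k, Finset.sum_add_distrib,
      Finset.sum_range_sub']
    simp
  have hre : ∀ N : ℕ, -(2 * ‖y‖) ≤ N * (φ x).re := by
    intro N
    have h1 : 0 ≤ ∑ k ∈ Finset.range N, η k x := Finset.sum_nonneg fun k _ => (hη k).1 c
    rw [hsum] at h1
    have h2 := (Complex.nonneg_iff.1 h1).1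
    have h3 := (Complex.abs_re_le_norm _).trans (norm_apply_le_of_apply_one (hη 0).1 (hη 0).2 y)
    have h4 := (Complex.abs_re_le_norm _).trans (norm_apply_le_of_apply_one (hη N).1 (hη N).2 y)
    simp only [Complex.add_re, Complex.sub_re, Complex.mul_re, Complex.natCast_re,
      Complex.natCast_im, zero_mul, sub_zero] at h2
    linarith [abs_le.1 h3, abs_le.1 h4]
  rw [Complex.nonneg_iff]
  constructor
  · by_contra! hneg
    obtain ⟨N, hN⟩ := exists_nat_gt (2 * ‖y‖ / -(φ x).re)
    rw [div_lt_iff₀ (by linarith)] at hN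
    linarith [hre N]
  · have h1 : conj (φ x) = φ x := by rw [← hφ.apply_star hφ1, hx, star_mul, star_star]
    exact (Complex.conj_eq_iff_im.1 h1).symm

/-- The invariant integral is faithful. -/
theorem IsInvariantIntegral.apply_star_mul_self_pos {φ : A →ₗ[ℂ] ℂ}
    (hφ : IsInvariantIntegral Coalgebra.comul 1 (HopfAlgebra.antipode ℂ) φ) (hφ1 : φ 1 = 1)
    {a : A} (ha : a ≠ 0) : 0 < φ (star a * a) := by
  let _ := FiniteHopfCStar.cstarAlgebra A
  have hpos := hφ.isPositiveFunctional hφ1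
  refine lt_of_le_of_ne (hpos a) fun h0 => ha ?_
  have hv := (Module.finBasis ℂ A).linearIndependent
  obtain ⟨x, hx⟩ := exists_eq_sum_tmul_basis (Module.finBasis ℂ A) (Coalgebra.comul (R := ℂ) a)
  obtain ⟨m, z, hz, hz0⟩ := exists_map_star_mul_self_eq_sum hpos x (Module.finBasis ℂ A)
  rw [← hx, ← comul_star_mul_self, hφ.left_inv, ← h0, zero_smul] at hz
  have hxx := hz0 hv (eq_zero_of_sum_star_mul_self_eq_zero z hz.symm)
  have hcx : ∀ c i, φ (c * x i) = 0 := by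
    intro c i
    have h := norm_apply_sq_le hpos (star c) (x i)
    rw [hxx, star_star, Complex.zero_re, mul_zero] at h
    exact norm_eq_zero.1 (pow_eq_zero_iff two_ne_zero |>.1 (le_antisymm h (sq_nonneg _)))
  -- `a = ∑ φ(S⁻¹(a₂) a₁) a₃`, where the right side vanishes as `φ(c a₁) = 0` for all `c`.
  let g : A ⊗[ℂ] A →ₗ[ℂ] ℂ := φ ∘ₗ LinearMap.mul' ℂ A ∘ₗ
    TensorProduct.map (antipodeInv A) LinearMap.id ∘ₗ (TensorProduct.comm ℂ A A).toLinearMap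
  have h := map_comul_coassoc
    ((TensorProduct.lid ℂ A).toLinearMap ∘ₗ TensorProduct.map g LinearMap.id)
    (((TensorProduct.lid ℂ A).toLinearMap ∘ₗ TensorProduct.map g LinearMap.id) ∘ₗ
      (TensorProduct.assoc ℂ A A A).symm.toLinearMap) (by intro x y z; simp) a
  have h1 : (TensorProduct.lid ℂ A).toLinearMap (TensorProduct.map g LinearMap.id
      (TensorProduct.map Coalgebra.comul LinearMap.id (Coalgebra.comul (R := ℂ) a))) = a := by
    have hg : g ∘ₗ Coalgebra.comul = Coalgebra.counit := by
      ext b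
      simp only [g, LinearMap.comp_apply, LinearEquiv.coe_coe, antipodeInv_mul_comul, map_smul, hφ1,
        smul_eq_mul, mul_one]
    rw [← LinearMap.comp_apply (TensorProduct.map g _), ← TensorProduct.map_comp, hg]
    exact congrArg (fun f => f a) (leftSlice_counit (C := A))
  rw [LinearMap.comp_apply, h1] at h
  rw [h, hx]
  simp only [map_sum]
  refine Finset.sum_eq_zero fun i _ => ?_
  simp only [TensorProduct.map_tmul, LinearMap.id_apply]
  induction Coalgebra.comul (R := ℂ) (Module.finBasis ℂ A i) with
  | zero => simp
  | tmul p q => simp [g, hcx]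
  | add p q hp hq => simp only [TensorProduct.tmul_add, map_add, hp, hq, add_zero]

end Integral

/-! ### Products over the threefold coproduct -/

section TripleProduct

variable {C E : Type*} [Ring C] [Ring E] [Algebra ℂ E]

/-- `x ⊗ (y ⊗ z) ↦ f(x) g(y) h(z)`. -/
noncomputable def tripleMul [Module ℂ C] (f g h : C →ₗ[ℂ] E) : C ⊗[ℂ] (C ⊗[ℂ] C) →ₗ[ℂ] E :=
  LinearMap.mul' ℂ E ∘ₗ TensorProduct.map f (LinearMap.mul' ℂ E ∘ₗ TensorProduct.map g h)

theorem tripleMul_tmul [Module ℂ C] (f g h : C →ₗ[ℂ] E) (x y z : C) :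
    tripleMul f g h (x ⊗ₜ (y ⊗ₜ z)) = f x * (g y * h z) := by
  simp [tripleMul]

theorem tripleTensor_induction {V : Type*} [AddCommGroup V] [Module ℂ V]
    {motive : V ⊗[ℂ] (V ⊗[ℂ] V) → Prop} (t : V ⊗[ℂ] (V ⊗[ℂ] V)) (zero : motive 0)
    (tmul : ∀ x y z, motive (x ⊗ₜ (y ⊗ₜ z)))
    (add : ∀ s t, motive s → motive t → motive (s + t)) : motive t := by
  induction t with
  | zero => exact zero
  | tmul x t =>
    induction t with
    | zero => simpa using zero
    | tmul y z => exact tmul x y z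
    | add s t hs ht => rw [TensorProduct.tmul_add]; exact add _ _ hs ht
  | add s t hs ht => exact add _ _ hs ht

variable [Algebra ℂ C]

/-- Pairwise commuting representations combine to a representation of the triple tensor product. -/
theorem tripleMul_mul {f g h : C →ₗ[ℂ] E} (hf : ∀ x y, f (x * y) = f x * f y)
    (hg : ∀ x y, g (x * y) = g x * g y) (hh : ∀ x y, h (x * y) = h x * h y)
    (hfg : ∀ x y, Commute (f x) (g y)) (hfh : ∀ x y, Commute (f x) (h y))
    (hgh : ∀ x y, Commute (g x) (h y)) (s t : C ⊗[ℂ] (C ⊗[ℂ] C)) :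
    tripleMul f g h (s * t) = tripleMul f g h s * tripleMul f g h t := by
  induction s using tripleTensor_induction with
  | zero => simp
  | add s s' hs hs' => rw [add_mul, map_add, hs, hs', map_add, add_mul]
  | tmul x y z =>
    induction t using tripleTensor_induction with
    | zero => simp
    | add t t' ht ht' => rw [mul_add, map_add, ht, ht', map_add, mul_add]
    | tmul x' y' z' =>
      simp only [Algebra.TensorProduct.tmul_mul_tmul, tripleMul_tmul, hf, hg, hh]
      have h1 : Commute (f x') (g y * h z) := (hfg x' y).mul_right (hfh x' z)
      calc f x * f x' * (g y * g y' * (h z * h z'))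
          = f x * (f x' * (g y * (g y' * h z) * h z')) := by simp only [mul_assoc]
        _ = f x * (f x' * (g y * h z) * (g y' * h z')) := by
            rw [(hgh y' z).eq]; simp only [mul_assoc]
        _ = f x * (g y * h z) * (f x' * (g y' * h z')) := by rw [h1.eq]; simp only [mul_assoc]

/-- Pairwise commuting antirepresentations combine to an antirepresentation of the triple tensor
product. -/
theorem tripleMul_mul_rev {f g h : C →ₗ[ℂ] E} (hf : ∀ x y, f (x * y) = f y * f x)
    (hg : ∀ x y, g (x * y) = g y * g x) (hh : ∀ x y, h (x * y) = h y * h x)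
    (hfg : ∀ x y, Commute (f x) (g y)) (hfh : ∀ x y, Commute (f x) (h y))
    (hgh : ∀ x y, Commute (g x) (h y)) (s t : C ⊗[ℂ] (C ⊗[ℂ] C)) :
    tripleMul f g h (s * t) = tripleMul f g h t * tripleMul f g h s := by
  induction s using tripleTensor_induction with
  | zero => simp
  | add s s' hs hs' => rw [add_mul, map_add, hs, hs', map_add, mul_add]
  | tmul x y z =>
    induction t using tripleTensor_induction with
    | zero => simp
    | add t t' ht ht' => rw [mul_add, map_add, ht, ht', map_add, add_mul]
    | tmul x' y' z' =>
      simp only [Algebra.TensorProduct.tmul_mul_tmul, tripleMul_tmul, hf, hg, hh]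
      have h1 : Commute (f x) (g y' * h z') := (hfg x y').mul_right (hfh x z')
      calc f x' * f x * (g y' * g y * (h z' * h z))
          = f x' * (f x * (g y' * (g y * h z') * h z)) := by simp only [mul_assoc]
        _ = f x' * (f x * (g y' * h z') * (g y * h z)) := by
            rw [(hgh y z').eq]; simp only [mul_assoc]
        _ = f x' * (g y' * h z') * (f x * (g y * h z)) := by rw [h1.eq]; simp only [mul_assoc]

theorem comul₃_mul {A : Type*} [Ring A] [HopfAlgebra ℂ A] (a b : A) :
    comul₃ A (a * b) = comul₃ A a * comul₃ A b := by
  have h : ∀ c : A, comul₃ A c = Algebra.TensorProduct.map (AlgHom.id ℂ A)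
      (Bialgebra.comulAlgHom ℂ A) (Coalgebra.comul (R := ℂ) c) := fun c => rfl
  rw [h, h, h, Bialgebra.comul_mul, map_mul]

/-- The outer contraction of `∑ a₁ ⊗ (a₂ ⊗ a₃)` acts on `a` by a slice from each side. -/
theorem contractOuter_comul₃_left {A W : Type*} [Ring A] [HopfAlgebra ℂ A] [AddCommGroup W]
    [Module ℂ W] (F G : A ⊗[ℂ] W →ₗ[ℂ] ℂ) (a : A) (x y z : W) :
    contractOuter F G (comul₃ A a ⊗ₜ (z ⊗ₜ (y ⊗ₜ x))) =
      rightSlice (G ∘ₗ (TensorProduct.mk ℂ A W).flip x)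
        (leftSlice (F ∘ₗ (TensorProduct.mk ℂ A W).flip z) a) ⊗ₜ y := by
  simp only [comul₃, leftSlice, LinearMap.comp_apply, LinearEquiv.coe_coe]
  induction Coalgebra.comul (R := ℂ) a with
  | zero => simp
  | add s t hs ht => simp only [map_add, TensorProduct.add_tmul, hs, ht]
  | tmul u c =>
    simp only [TensorProduct.map_tmul, LinearMap.id_apply, TensorProduct.lid_tmul, map_smul,
      rightSlice, LinearMap.comp_apply, LinearEquiv.coe_coe]
    induction Coalgebra.comul (R := ℂ) c with
    | zero => simp
    | add s t hs ht => simp only [map_add, TensorProduct.add_tmul, TensorProduct.tmul_add,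
        smul_add, hs, ht]
    | tmul v w => simp [contractOuter, TensorProduct.smul_tmul']

theorem contractOuter_comul₃_right {B V : Type*} [Ring B] [HopfAlgebra ℂ B] [AddCommGroup V]
    [Module ℂ V] (F G : V ⊗[ℂ] B →ₗ[ℂ] ℂ) (u v w : V) (b : B) :
    contractOuter F G ((u ⊗ₜ (v ⊗ₜ w)) ⊗ₜ reverse₃ B (comul₃ B b)) =
      v ⊗ₜ rightSlice (F ∘ₗ TensorProduct.mk ℂ V B u)
        (leftSlice (G ∘ₗ TensorProduct.mk ℂ V B w) b) := by
  simp only [comul₃, leftSlice, LinearMap.comp_apply, LinearEquiv.coe_coe]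
  induction Coalgebra.comul (R := ℂ) b with
  | zero => simp
  | add s t hs ht => simp only [map_add, TensorProduct.tmul_add, hs, ht]
  | tmul x c =>
    simp only [TensorProduct.map_tmul, LinearMap.id_apply, TensorProduct.lid_tmul, map_smul,
      rightSlice, LinearMap.comp_apply, LinearEquiv.coe_coe]
    induction Coalgebra.comul (R := ℂ) c with
    | zero => simp
    | add s t hs ht => simp only [map_add, TensorProduct.tmul_add, smul_add, hs, ht]
    | tmul y z => simp [contractOuter, reverse₃, smul_smul, mul_comm]

end TripleProduct

/-! ### Slice operators and their tensor products -/

section Slices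

variable {C : Type*} [AddCommGroup C] [Module ℂ C] [Coalgebra ℂ C]

/-- `leftSlice`, as a linear map in the functional. -/
noncomputable def leftSliceₗ : (C →ₗ[ℂ] ℂ) →ₗ[ℂ] Module.End ℂ C where
  toFun := leftSlice
  map_add' := leftSlice_add
  map_smul' := leftSlice_smul

/-- `rightSlice`, as a linear map in the functional. -/
noncomputable def rightSliceₗ : (C →ₗ[ℂ] ℂ) →ₗ[ℂ] Module.End ℂ C where
  toFun := rightSlice
  map_add' f g := by
    rw [rightSlice, TensorProduct.map_add_right, LinearMap.add_comp, LinearMap.comp_add]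
    rfl
  map_smul' r f := by
    rw [rightSlice, TensorProduct.map_smul_right, LinearMap.smul_comp, LinearMap.comp_smul]
    rfl

theorem leftSliceₗ_apply (f : C →ₗ[ℂ] ℂ) : leftSliceₗ f = leftSlice f := rfl

theorem rightSliceₗ_apply (f : C →ₗ[ℂ] ℂ) : rightSliceₗ f = rightSlice f := rfl

theorem leftSliceₗ_convolve (f g : C →ₗ[ℂ] ℂ) :
    leftSliceₗ (convolve f g) = leftSliceₗ g * leftSliceₗ f :=
  LinearMap.ext fun c => (leftSlice_leftSlice g f c).symm

theorem rightSliceₗ_convolve (f g : C →ₗ[ℂ] ℂ) :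
    rightSliceₗ (convolve f g) = rightSliceₗ f * rightSliceₗ g :=
  LinearMap.ext fun c => (rightSlice_rightSlice f g c).symm

theorem commute_rightSliceₗ_leftSliceₗ (f g : C →ₗ[ℂ] ℂ) :
    Commute (rightSliceₗ f) (leftSliceₗ g) :=
  LinearMap.ext fun c => (leftSlice_rightSlice g f c).symm

end Slices

section EndTensor

variable {V : Type*} (W : Type*) [AddCommGroup V] [Module ℂ V] [AddCommGroup W] [Module ℂ W]

/-- `f ↦ f ⊗ id`. -/
noncomputable def endRTensor : Module.End ℂ V →ₗ[ℂ] Module.End ℂ (V ⊗[ℂ] W) :=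
  LinearMap.rTensorHom W

/-- `f ↦ id ⊗ f`. -/
noncomputable def endLTensor : Module.End ℂ V →ₗ[ℂ] Module.End ℂ (W ⊗[ℂ] V) :=
  LinearMap.lTensorHom W

theorem endRTensor_tmul (f : Module.End ℂ V) (v : V) (w : W) :
    endRTensor W f (v ⊗ₜ w) = f v ⊗ₜ w := rfl

theorem endLTensor_tmul (f : Module.End ℂ V) (v : V) (w : W) :
    endLTensor W f (w ⊗ₜ v) = w ⊗ₜ f v := rfl

theorem endRTensor_mul (f g : Module.End ℂ V) :
    endRTensor W (f * g) = endRTensor W f * endRTensor W g :=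
  LinearMap.rTensor_mul W f g

theorem endLTensor_mul (f g : Module.End ℂ V) :
    endLTensor W (f * g) = endLTensor W f * endLTensor W g :=
  LinearMap.lTensor_mul W f g

theorem commute_endRTensor_endLTensor (f : Module.End ℂ V) (g : Module.End ℂ W) :
    Commute (endRTensor W f) (endLTensor V g) := by
  refine TensorProduct.ext' fun v w => ?_
  simp only [Module.End.mul_apply, endRTensor_tmul, endLTensor_tmul]

theorem commute_endRTensor {f g : Module.End ℂ V} (h : Commute f g) :
    Commute (endRTensor W f) (endRTensor W g) := by
  rw [Commute, SemiconjBy, ← endRTensor_mul, h.eq, endRTensor_mul]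

theorem commute_endLTensor {f g : Module.End ℂ V} (h : Commute f g) :
    Commute (endLTensor W f) (endLTensor W g) := by
  rw [Commute, SemiconjBy, ← endLTensor_mul, h.eq, endLTensor_mul]

end EndTensor

/-! ### Associativity of the double -/

section Double

variable {A B : Type*} [NormedRing A] [StarRing A] [HopfAlgebra ℂ A] [FiniteHopfCStar A]
  [NormedRing B] [StarRing B] [HopfAlgebra ℂ B] [FiniteHopfCStar B]
  {p : A →ₗ[ℂ] B →ₗ[ℂ] ℂ}

theorem IsHopfPairing.convolve_flip (hp : IsHopfPairing p) (b b' : B) :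
    convolve (p.flip b) (p.flip b') = p.flip (b * b') :=
  LinearMap.ext fun a => hp.comul_left a b b'

theorem IsHopfPairing.convolve_apply (hp : IsHopfPairing p) (a a' : A) :
    convolve (p a) (p a') = p (a * a') :=
  LinearMap.ext fun b => hp.comul_right a a' b

theorem IsHopfPairing.flip_one (hp : IsHopfPairing p) : p.flip 1 = Coalgebra.counit :=
  LinearMap.ext hp.one_right

theorem IsHopfPairing.antipodeInv_left (hp : IsHopfPairing p) (a : A) (b : B) :
    p (antipodeInv A a) b = p a (antipodeInv B b) := by
  rw [← antipode_antipodeInv b, ← hp.antipode_left, antipode_antipodeInv, antipode_antipodeInv]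

namespace QuantumDouble

/-- Left multiplication by `(1, b)` on the double comes from three representations of `B`: on `A` by
right slices `a ↦ ∑ a₁ ⟨a₂, b⟩`, on `B` by left multiplication, and on `A` by left slices
`a ↦ ∑ ⟨a₁, S⁻¹ b⟩ a₂`. -/
theorem cross_tmul_eq_tripleMul_left (a : A) (b b' : B) :
    TensorProduct.map LinearMap.id (LinearMap.mulRight ℂ b') (cross p (antipodeInv B) (a ⊗ₜ b)) =
      tripleMul (endRTensor B ∘ₗ rightSliceₗ ∘ₗ p.flip)
        (endLTensor A ∘ₗ LinearMap.mul ℂ B)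
        (endRTensor B ∘ₗ leftSliceₗ ∘ₗ p.flip ∘ₗ antipodeInv B) (comul₃ B b)
        (a ⊗ₜ[ℂ] b') := by
  simp only [cross, LinearMap.comp_apply, TensorProduct.map_tmul]
  induction comul₃ B b using tripleTensor_induction with
  | zero => simp
  | add s t hs ht => simp only [map_add, TensorProduct.tmul_add, hs, ht, LinearMap.add_apply]
  | tmul x y z =>
    have h : reverse₃ B (x ⊗ₜ[ℂ] (y ⊗ₜ[ℂ] z)) = z ⊗ₜ (y ⊗ₜ x) := by simp [reverse₃]
    rw [h, contractOuter_comul₃_left, tripleMul_tmul]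
    simp [endRTensor_tmul, endLTensor_tmul, rightSliceₗ_apply, leftSliceₗ_apply]
    rfl

/-- Right multiplication by `(a, 1)` on the double comes from three antirepresentations of `A`: two
by slices on `B`, and one by right multiplication on `A`. -/
theorem cross_tmul_eq_tripleMul_right (a a' : A) (b : B) :
    TensorProduct.map (LinearMap.mulLeft ℂ a') LinearMap.id (cross p (antipodeInv B) (a ⊗ₜ b)) =
      tripleMul
        (endLTensor A ∘ₗ rightSliceₗ ∘ₗ (LinearMap.lcomp ℂ ℂ (antipodeInv B)) ∘ₗ p)
        (endRTensor B ∘ₗ (LinearMap.mul ℂ A).flip)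
        (endLTensor A ∘ₗ leftSliceₗ ∘ₗ p) (comul₃ A a) (a' ⊗ₜ[ℂ] b) := by
  simp only [cross, LinearMap.comp_apply, TensorProduct.map_tmul]
  induction comul₃ A a using tripleTensor_induction with
  | zero => simp
  | add s t hs ht => simp only [map_add, TensorProduct.add_tmul, hs, ht, LinearMap.add_apply]
  | tmul u v w =>
    rw [contractOuter_comul₃_right, tripleMul_tmul]
    simp [endRTensor_tmul, endLTensor_tmul, rightSliceₗ_apply, leftSliceₗ_apply]
    rfl

/-- `(1, b)(1, b') y = (1, b b') y`. -/
theorem mul_inclB_mul (hp : IsHopfPairing p) (b b' : B) (y : A ⊗[ℂ] B) :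
    mul p (1 ⊗ₜ (b * b')) y = mul p (1 ⊗ₜ b) (mul p (1 ⊗ₜ b') y) := by
  have key : ∀ b : B, mul p (1 ⊗ₜ b) =
      tripleMul (endRTensor B ∘ₗ rightSliceₗ ∘ₗ p.flip) (endLTensor A ∘ₗ LinearMap.mul ℂ B)
        (endRTensor B ∘ₗ leftSliceₗ ∘ₗ p.flip ∘ₗ antipodeInv B) (comul₃ B b) := by
    intro b
    refine TensorProduct.ext' fun a b' => ?_
    rw [mul_tmul, ← cross_tmul_eq_tripleMul_left, LinearMap.mulLeft_one]
  rw [key, key, key, comul₃_mul, tripleMul_mul]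
  · rfl
  · intro x y
    simp only [LinearMap.comp_apply]
    rw [← hp.convolve_flip, rightSliceₗ_convolve, endRTensor_mul]
  · intro x y
    simp only [LinearMap.comp_apply]
    rw [← endLTensor_mul]
    congr 1
    ext z
    simp [mul_assoc]
  · intro x y
    simp only [LinearMap.comp_apply]
    rw [antipodeInv_mul, ← hp.convolve_flip, leftSliceₗ_convolve, endRTensor_mul]
  · exact fun x y => commute_endRTensor_endLTensor B _ _
  · exact fun x y => commute_endRTensor B (commute_rightSliceₗ_leftSliceₗ _ _)
  · exact fun x y => (commute_endRTensor_endLTensor B _ _).symm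

/-- `y (a, 1)(a', 1) = y (a a', 1)`. -/
theorem mul_mul_inclA (hp : IsHopfPairing p) (a a' : A) (y : A ⊗[ℂ] B) :
    mul p y ((a * a') ⊗ₜ 1) = mul p (mul p y (a ⊗ₜ 1)) (a' ⊗ₜ 1) := by
  have key : ∀ a : A, (mul p).flip (a ⊗ₜ 1) =
      tripleMul (endLTensor A ∘ₗ rightSliceₗ ∘ₗ (LinearMap.lcomp ℂ ℂ (antipodeInv B)) ∘ₗ p)
        (endRTensor B ∘ₗ (LinearMap.mul ℂ A).flip) (endLTensor A ∘ₗ leftSliceₗ ∘ₗ p)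
        (comul₃ A a) := by
    intro a
    refine TensorProduct.ext' fun a' b => ?_
    rw [LinearMap.flip_apply, mul_tmul, ← cross_tmul_eq_tripleMul_right, LinearMap.mulRight_one]
  have hinv : ∀ a : A, LinearMap.lcomp ℂ ℂ (antipodeInv B) (p a) = p (antipodeInv A a) :=
    fun a => LinearMap.ext fun b => (hp.antipodeInv_left a b).symm
  have h : (mul p).flip ((a * a') ⊗ₜ 1) = (mul p).flip (a' ⊗ₜ 1) * (mul p).flip (a ⊗ₜ 1) := by
    rw [key, key, key, comul₃_mul, tripleMul_mul_rev]
    · intro x y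
      simp only [LinearMap.comp_apply]
      rw [hinv, hinv, hinv, antipodeInv_mul, ← hp.convolve_apply, rightSliceₗ_convolve,
        endLTensor_mul]
    · intro x y
      simp only [LinearMap.comp_apply]
      rw [← endRTensor_mul]
      congr 1
      ext z
      simp [mul_assoc]
    · intro x y
      simp only [LinearMap.comp_apply]
      rw [← hp.convolve_apply, leftSliceₗ_convolve, endLTensor_mul]
    · exact fun x y => (commute_endRTensor_endLTensor B _ _).symm
    · exact fun x y => commute_endLTensor A (commute_rightSliceₗ_leftSliceₗ _ _)
    · exact fun x y => commute_endRTensor_endLTensor B _ _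
  exact congrArg (fun f => f y) h

theorem mul_map_mulLeft (a : A) (x y : A ⊗[ℂ] B) :
    mul p (TensorProduct.map (LinearMap.mulLeft ℂ a) LinearMap.id x) y =
      TensorProduct.map (LinearMap.mulLeft ℂ a) LinearMap.id (mul p x y) := by
  induction x with
  | zero => simp
  | add x x' hx hx' => simp only [map_add, LinearMap.add_apply, hx, hx']
  | tmul a₁ b₁ =>
    induction y with
    | zero => simp
    | add y y' hy hy' => simp only [map_add, hy, hy']
    | tmul a₂ b₂ =>
      simp only [TensorProduct.map_tmul, LinearMap.id_apply, mul_tmul, LinearMap.mulLeft_apply]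
      induction cross p (antipodeInv B) (a₂ ⊗ₜ b₁) with
      | zero => simp
      | add s t hs ht => simp only [map_add, hs, ht]
      | tmul u v => simp

theorem mul_map_mulRight (b : B) (x y : A ⊗[ℂ] B) :
    mul p x (TensorProduct.map LinearMap.id (LinearMap.mulRight ℂ b) y) =
      TensorProduct.map LinearMap.id (LinearMap.mulRight ℂ b) (mul p x y) := by
  induction x with
  | zero => simp
  | add x x' hx hx' => simp only [map_add, LinearMap.add_apply, hx, hx']
  | tmul a₁ b₁ =>
    induction y with
    | zero => simp
    | add y y' hy hy' => simp only [map_add, hy, hy']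
    | tmul a₂ b₂ =>
      simp only [TensorProduct.map_tmul, LinearMap.id_apply, mul_tmul, LinearMap.mulRight_apply]
      induction cross p (antipodeInv B) (a₂ ⊗ₜ b₁) with
      | zero => simp
      | add s t hs ht => simp only [map_add, hs, ht]
      | tmul u v => simp [mul_assoc]

theorem mul_tmul_left (a : A) (b : B) (y : A ⊗[ℂ] B) :
    mul p (a ⊗ₜ b) y =
      TensorProduct.map (LinearMap.mulLeft ℂ a) LinearMap.id (mul p (1 ⊗ₜ b) y) := by
  rw [← mul_map_mulLeft]
  simp

theorem mul_tmul_right (a : A) (b : B) (x : A ⊗[ℂ] B) :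
    mul p x (a ⊗ₜ b) =
      TensorProduct.map LinearMap.id (LinearMap.mulRight ℂ b) (mul p x (a ⊗ₜ 1)) := by
  rw [← mul_map_mulRight]
  simp

/-- `(1, b)((a, 1) z) = ((1, b)(a, 1)) z`. -/
theorem mul_inclB_map_mulLeft (hp : IsHopfPairing p) (a : A) (b : B) (z : A ⊗[ℂ] B) :
    mul p (1 ⊗ₜ b) (TensorProduct.map (LinearMap.mulLeft ℂ a) LinearMap.id z) =
      mul p (mul p (1 ⊗ₜ b) (a ⊗ₜ 1)) z := by
  induction z with
  | zero => simp
  | add z z' hz hz' => simp only [map_add, hz, hz']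
  | tmul a₁ b₁ =>
    rw [TensorProduct.map_tmul, LinearMap.mulLeft_apply, LinearMap.id_apply, mul_tmul_right,
      mul_mul_inclA hp, ← mul_tmul_right]

/-- `(z (1, b))(a, 1) = z ((1, b)(a, 1))`. -/
theorem mul_map_mulRight_inclA (hp : IsHopfPairing p) (a : A) (b : B) (z : A ⊗[ℂ] B) :
    mul p (TensorProduct.map LinearMap.id (LinearMap.mulRight ℂ b) z) (a ⊗ₜ 1) =
      mul p z (mul p (1 ⊗ₜ b) (a ⊗ₜ 1)) := by
  induction z with
  | zero => simp
  | add z z' hz hz' => simp only [map_add, LinearMap.add_apply, hz, hz']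
  | tmul a₁ b₁ =>
    rw [TensorProduct.map_tmul, LinearMap.mulRight_apply, LinearMap.id_apply, mul_tmul_left,
      mul_inclB_mul hp, ← mul_tmul_left]

theorem mul_associative (hp : IsHopfPairing p) (x y z : A ⊗[ℂ] B) :
    mul p (mul p x y) z = mul p x (mul p y z) := by
  induction x with
  | zero => simp
  | add x x' hx hx' => simp only [map_add, LinearMap.add_apply, hx, hx']
  | tmul a b =>
  induction y with
  | zero => simp
  | add y y' hy hy' => simp only [map_add, LinearMap.add_apply, hy, hy']
  | tmul a' b' =>
  induction z with
  | zero => simp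
  | add z z' hz hz' => simp only [map_add, hz, hz']
  | tmul a'' b'' =>
    rw [mul_tmul_left a b, mul_map_mulLeft, mul_tmul_left a b, mul_tmul_right a'' b'',
      mul_tmul_right a' b', mul_map_mulRight_inclA hp, mul_tmul_right a'' b'' (a' ⊗ₜ b'),
      mul_map_mulRight, mul_tmul_left a' b', mul_inclB_map_mulLeft hp]

end QuantumDouble

end Double

/-! ### Twisting by the coproduct of the second factor -/

section Twist

variable {V C : Type*} [AddCommGroup V] [Module ℂ V] [AddCommGroup C] [Module ℂ C] [Coalgebra ℂ C]

/-- For `κ : C → End V`, the map `v ⊗ c ↦ ∑ κ(c₁) v ⊗ c₂`. -/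
noncomputable def twistLeft (κ : C →ₗ[ℂ] Module.End ℂ V) : V ⊗[ℂ] C →ₗ[ℂ] V ⊗[ℂ] C :=
  TensorProduct.map (TensorProduct.lift κ.flip) LinearMap.id ∘ₗ
    (TensorProduct.assoc ℂ V C C).symm.toLinearMap ∘ₗ
      TensorProduct.map LinearMap.id Coalgebra.comul

/-- For `κ : C → End V`, the map `v ⊗ c ↦ ∑ κ(c₂) v ⊗ c₁`. -/
noncomputable def twistRight (κ : C →ₗ[ℂ] Module.End ℂ V) : V ⊗[ℂ] C →ₗ[ℂ] V ⊗[ℂ] C :=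
  TensorProduct.map (TensorProduct.lift κ.flip) LinearMap.id ∘ₗ
    (TensorProduct.assoc ℂ V C C).symm.toLinearMap ∘ₗ
      TensorProduct.map LinearMap.id ((TensorProduct.comm ℂ C C).toLinearMap ∘ₗ Coalgebra.comul)

theorem twistLeft_tmul (κ : C →ₗ[ℂ] Module.End ℂ V) (v : V) (c : C) :
    twistLeft κ (v ⊗ₜ c) =
      TensorProduct.map (κ.flip v) LinearMap.id (Coalgebra.comul (R := ℂ) c) := by
  simp only [twistLeft, LinearMap.comp_apply, TensorProduct.map_tmul, LinearMap.id_apply,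
    LinearEquiv.coe_coe]
  induction Coalgebra.comul (R := ℂ) c with
  | zero => simp
  | tmul x y => simp
  | add x y hx hy => simp only [map_add, TensorProduct.tmul_add, hx, hy]

theorem twistRight_tmul (κ : C →ₗ[ℂ] Module.End ℂ V) (v : V) (c : C) :
    twistRight κ (v ⊗ₜ c) = TensorProduct.map (κ.flip v) LinearMap.id
      (TensorProduct.comm ℂ C C (Coalgebra.comul (R := ℂ) c)) := by
  simp only [twistRight, LinearMap.comp_apply, TensorProduct.map_tmul, LinearMap.id_apply,
    LinearEquiv.coe_coe]
  induction Coalgebra.comul (R := ℂ) c with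
  | zero => simp
  | tmul x y => simp
  | add x y hx hy => simp only [map_add, TensorProduct.tmul_add, hx, hy]

/-- If `∑ κ'(c₂) κ(c₁) = ε(c)`, then the twist by `κ'` inverts the twist by `κ`. -/
theorem twistLeft_twistLeft {κ κ' : C →ₗ[ℂ] Module.End ℂ V}
    (h : ∀ c : C, LinearMap.mul' ℂ (Module.End ℂ V) (TensorProduct.map κ' κ
      (TensorProduct.comm ℂ C C (Coalgebra.comul (R := ℂ) c))) =
        Coalgebra.counit (R := ℂ) c • (1 : Module.End ℂ V)) (x : V ⊗[ℂ] C) :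
    twistLeft κ' (twistLeft κ x) = x := by
  induction x with
  | zero => simp
  | add x y hx hy => simp only [map_add, hx, hy]
  | tmul v c =>
    let g : C ⊗[ℂ] C →ₗ[ℂ] V := LinearMap.applyₗ v ∘ₗ LinearMap.mul' ℂ (Module.End ℂ V) ∘ₗ
      TensorProduct.map κ' κ ∘ₗ (TensorProduct.comm ℂ C C).toLinearMap
    have h1 := map_comul_coassoc (TensorProduct.map g LinearMap.id)
      (TensorProduct.map g LinearMap.id ∘ₗ (TensorProduct.assoc ℂ C C C).symm.toLinearMap)
      (by intro x y z; simp) c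
    have h2 : TensorProduct.map g LinearMap.id
        (TensorProduct.map Coalgebra.comul LinearMap.id (Coalgebra.comul (R := ℂ) c)) =
          v ⊗ₜ[ℂ] c := by
      have hg : g ∘ₗ Coalgebra.comul = LinearMap.toSpanSingleton ℂ V v ∘ₗ Coalgebra.counit := by
        ext b
        simp only [g, LinearMap.comp_apply, LinearEquiv.coe_coe, h]
        simp
      rw [← LinearMap.comp_apply, ← TensorProduct.map_comp, hg, ← LinearMap.id_comp LinearMap.id,
        TensorProduct.map_comp, LinearMap.comp_apply]
      have := Coalgebra.rTensor_counit_comul (R := ℂ) c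
      simp only [LinearMap.rTensor] at this
      simp [this]
    refine Eq.trans ?_ (h1.symm.trans h2)
    rw [twistLeft_tmul]
    simp only [LinearMap.comp_apply, LinearEquiv.coe_coe]
    induction Coalgebra.comul (R := ℂ) c with
    | zero => simp
    | add s t hs ht => simp only [map_add, hs, ht]
    | tmul a b =>
      simp only [TensorProduct.map_tmul, LinearMap.id_apply, twistLeft_tmul]
      induction Coalgebra.comul (R := ℂ) b with
      | zero => simp
      | add s t hs ht => simp only [map_add, TensorProduct.tmul_add, hs, ht]
      | tmul b₁ b₂ => simp [g]

/-- If `∑ κ'(c₁) κ(c₂) = ε(c)`, then the twist by `κ'` inverts the twist by `κ`. -/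
theorem twistRight_twistRight {κ κ' : C →ₗ[ℂ] Module.End ℂ V}
    (h : ∀ c : C, LinearMap.mul' ℂ (Module.End ℂ V) (TensorProduct.map κ' κ
      (Coalgebra.comul (R := ℂ) c)) =
        Coalgebra.counit (R := ℂ) c • (1 : Module.End ℂ V)) (x : V ⊗[ℂ] C) :
    twistRight κ' (twistRight κ x) = x := by
  induction x with
  | zero => simp
  | add x y hx hy => simp only [map_add, hx, hy]
  | tmul v c =>
    let g : C ⊗[ℂ] C →ₗ[ℂ] V := LinearMap.applyₗ v ∘ₗ LinearMap.mul' ℂ (Module.End ℂ V) ∘ₗ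
      TensorProduct.map κ' κ
    have h1 := map_comul_coassoc
      ((TensorProduct.comm ℂ C V).toLinearMap ∘ₗ TensorProduct.map LinearMap.id g ∘ₗ
        (TensorProduct.assoc ℂ C C C).toLinearMap)
      ((TensorProduct.comm ℂ C V).toLinearMap ∘ₗ TensorProduct.map LinearMap.id g)
      (by intro x y z; simp) c
    have h2 : ((TensorProduct.comm ℂ C V).toLinearMap ∘ₗ TensorProduct.map LinearMap.id g)
        (TensorProduct.map LinearMap.id Coalgebra.comul (Coalgebra.comul (R := ℂ) c)) =
          v ⊗ₜ[ℂ] c := by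
      have hg : g ∘ₗ Coalgebra.comul = LinearMap.toSpanSingleton ℂ V v ∘ₗ Coalgebra.counit := by
        ext b
        simp only [g, LinearMap.comp_apply, h]
        simp
      rw [LinearMap.comp_apply, ← LinearMap.comp_apply (TensorProduct.map _ _),
        ← TensorProduct.map_comp, hg, ← LinearMap.id_comp LinearMap.id,
        TensorProduct.map_comp, LinearMap.comp_apply]
      have := Coalgebra.lTensor_counit_comul (R := ℂ) c
      simp only [LinearMap.lTensor] at this
      simp [this]
    refine Eq.trans ?_ (h1.trans h2)
    rw [twistRight_tmul]
    simp only [LinearMap.comp_apply, LinearEquiv.coe_coe]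
    induction Coalgebra.comul (R := ℂ) c with
    | zero => simp
    | add s t hs ht => simp only [map_add, hs, ht]
    | tmul a b =>
      simp only [TensorProduct.map_tmul, TensorProduct.comm_tmul, LinearMap.id_apply,
        twistRight_tmul]
      induction Coalgebra.comul (R := ℂ) a with
      | zero => simp
      | add s t hs ht => simp only [map_add, TensorProduct.add_tmul, hs, ht]
      | tmul a₁ a₂ => simp [g]

theorem twistLeft_twistRight {κ κ' : C →ₗ[ℂ] Module.End ℂ V}
    (h : ∀ c c', Commute (κ c) (κ' c')) (x : V ⊗[ℂ] C) :
    twistLeft κ (twistRight κ' x) = twistRight κ' (twistLeft κ x) := by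
  induction x with
  | zero => simp
  | add x y hx hy => simp only [map_add, hx, hy]
  | tmul v c =>
    let G : C ⊗[ℂ] (C ⊗[ℂ] C) →ₗ[ℂ] V ⊗[ℂ] C :=
      TensorProduct.map (TensorProduct.lift κ.flip) LinearMap.id ∘ₗ
      (TensorProduct.assoc ℂ V C C).symm.toLinearMap ∘ₗ (TensorProduct.comm ℂ (C ⊗[ℂ] C) V) ∘ₗ
      TensorProduct.map LinearMap.id (κ'.flip v) ∘ₗ (TensorProduct.assoc ℂ C C C).symm.toLinearMap
    have h1 := map_comul_coassoc (G ∘ₗ (TensorProduct.assoc ℂ C C C).toLinearMap) G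
      (by intro x y z; simp) c
    have h2 : twistLeft κ (twistRight κ' (v ⊗ₜ c)) = (G ∘ₗ (TensorProduct.assoc ℂ C C C).toLinearMap)
        (TensorProduct.map Coalgebra.comul LinearMap.id (Coalgebra.comul (R := ℂ) c)) := by
      rw [twistRight_tmul]
      induction Coalgebra.comul (R := ℂ) c with
      | zero => simp
      | add s t hs ht => simp only [map_add, hs, ht]
      | tmul a b =>
        simp only [TensorProduct.map_tmul, TensorProduct.comm_tmul, LinearMap.id_apply,
          twistLeft_tmul]
        induction Coalgebra.comul (R := ℂ) a with
        | zero => simp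
        | add s t hs ht => simp only [map_add, TensorProduct.add_tmul, hs, ht]
        | tmul a₁ a₂ => simp [G]
    have h3 : twistRight κ' (twistLeft κ (v ⊗ₜ c)) =
        G (TensorProduct.map LinearMap.id Coalgebra.comul (Coalgebra.comul (R := ℂ) c)) := by
      rw [twistLeft_tmul]
      induction Coalgebra.comul (R := ℂ) c with
      | zero => simp
      | add s t hs ht => simp only [map_add, hs, ht]
      | tmul a b =>
        simp only [TensorProduct.map_tmul, LinearMap.id_apply, twistRight_tmul]
        induction Coalgebra.comul (R := ℂ) b with
        | zero => simp
        | add s t hs ht => simp only [map_add, TensorProduct.tmul_add, hs, ht]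
        | tmul b₁ b₂ =>
          have := congrArg (fun f => f v) (h a b₂).eq
          simp only [Module.End.mul_apply] at this
          simp [G, this]
    rw [h2, h3, h1]

end Twist

/-! ### The involution of the double -/

section Double

variable {A B : Type*} [NormedRing A] [StarRing A] [HopfAlgebra ℂ A] [FiniteHopfCStar A]
  [NormedRing B] [StarRing B] [HopfAlgebra ℂ B] [FiniteHopfCStar B]
  {p : A →ₗ[ℂ] B →ₗ[ℂ] ℂ}

theorem IsHopfPairing.starFunctional_flip_star (hp : IsHopfPairing p) (b : B) :
    starFunctional (p.flip (star b)) = p.flip (antipodeInv B b) := by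
  ext a
  rw [starFunctional_apply, LinearMap.flip_apply, hp.star_left, Complex.conj_conj]
  rfl

theorem IsHopfPairing.starFunctional_flip_antipodeInv_star (hp : IsHopfPairing p) (b : B) :
    starFunctional (p.flip (antipodeInv B (star b))) = p.flip b := by
  have h : antipodeInv B (star b) = star (HopfAlgebra.antipode ℂ b) := by
    change star (HopfAlgebra.antipode ℂ (star (star b))) = _
    rw [star_star]
  rw [h, hp.starFunctional_flip_star, antipodeInv_antipode]

theorem star_twistLeft_star {κ κ' : B →ₗ[ℂ] Module.End ℂ A}
    (h : ∀ a b, star (κ (star b) (star a)) = κ' b a) (x : A ⊗[ℂ] B) :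
    star (twistLeft κ (star x)) = twistLeft κ' x := by
  induction x with
  | zero => simp
  | add x y hx hy => simp only [map_add, star_add, hx, hy]
  | tmul a b =>
    rw [TensorProduct.star_tmul, twistLeft_tmul, twistLeft_tmul, FiniteHopfCStar.comul_star]
    induction Coalgebra.comul (R := ℂ) b with
    | zero => simp
    | add x y hx hy => simp only [map_add, star_add, hx, hy]
    | tmul x y => simp [h]

theorem star_twistRight_star {κ κ' : B →ₗ[ℂ] Module.End ℂ A}
    (h : ∀ a b, star (κ (star b) (star a)) = κ' b a) (x : A ⊗[ℂ] B) :
    star (twistRight κ (star x)) = twistRight κ' x := by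
  induction x with
  | zero => simp
  | add x y hx hy => simp only [map_add, star_add, hx, hy]
  | tmul a b =>
    rw [TensorProduct.star_tmul, twistRight_tmul, twistRight_tmul, FiniteHopfCStar.comul_star]
    induction Coalgebra.comul (R := ℂ) b with
    | zero => simp
    | add x y hx hy => simp only [map_add, star_add, hx, hy]
    | tmul x y => simp [h]

namespace QuantumDouble

/-- The cross term pairs `b₁` with the last leg of `a` and `b₃` with the first one, one after the
other. -/
theorem cross_eq_twistRight_twistLeft (T : B →ₗ[ℂ] B) (x : A ⊗[ℂ] B) :
    cross p T x =
      twistRight (leftSliceₗ ∘ₗ p.flip ∘ₗ T) (twistLeft (rightSliceₗ ∘ₗ p.flip) x) := by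
  induction x with
  | zero => simp
  | add x y hx hy => simp only [map_add, hx, hy]
  | tmul a b =>
    have hb : comul₃ B b = TensorProduct.map LinearMap.id Coalgebra.comul
      (Coalgebra.comul (R := ℂ) b) := rfl
    rw [twistLeft_tmul]
    simp only [cross, LinearMap.comp_apply, TensorProduct.map_tmul, hb]
    induction Coalgebra.comul (R := ℂ) b with
    | zero => simp
    | add s t hs ht => simp only [map_add, TensorProduct.tmul_add, hs, ht]
    | tmul x c =>
      simp only [TensorProduct.map_tmul, LinearMap.id_apply, twistRight_tmul]
      induction Coalgebra.comul (R := ℂ) c with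
      | zero => simp
      | add s t hs ht => simp only [map_add, TensorProduct.tmul_add, hs, ht]
      | tmul y z =>
        have h : reverse₃ B (x ⊗ₜ[ℂ] (y ⊗ₜ[ℂ] z)) = z ⊗ₜ (y ⊗ₜ x) := by simp [reverse₃]
        rw [h, contractOuter_comul₃_left, ← leftSlice_rightSlice]
        simp [rightSliceₗ_apply, leftSliceₗ_apply]
        rfl

/-- The map `a ⊗ b ↦ (1, b)(a, 1)` and its conjugate by the involution of `A ⊗ B` are mutually
inverse. -/
theorem involution_involution (hp : IsHopfPairing p) (x : A ⊗[ℂ] B) :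
    involution p (involution p x) = x := by
  have hR : ∀ y : A ⊗[ℂ] B, star (cross p (antipodeInv B) (star y)) =
      twistRight (leftSliceₗ ∘ₗ p.flip)
        (twistLeft (rightSliceₗ ∘ₗ p.flip ∘ₗ antipodeInv B) y) := by
    intro y
    rw [cross_eq_twistRight_twistLeft,
      ← star_star (twistLeft (rightSliceₗ ∘ₗ p.flip) (star y)),
      star_twistRight_star (κ' := leftSliceₗ ∘ₗ p.flip), star_twistLeft_star]
    · intro a b
      simp only [LinearMap.comp_apply, rightSliceₗ_apply, star_rightSlice_star,
        hp.starFunctional_flip_star]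
    · intro a b
      simp only [LinearMap.comp_apply, leftSliceₗ_apply, star_leftSlice_star,
        hp.starFunctional_flip_antipodeInv_star]
  have hinv : ∀ y : A ⊗[ℂ] B, star (cross p (antipodeInv B) (star (cross p (antipodeInv B) y))) =
      y := by
    intro y
    rw [hR, cross_eq_twistRight_twistLeft, twistLeft_twistRight, twistRight_twistRight,
      twistLeft_twistLeft]
    · intro b
      have h := congrArg (fun c => (rightSliceₗ ∘ₗ p.flip) c) (antipodeInv_mul_comul b)
      simp only [map_smul] at h
      rw [LinearMap.comp_apply _ _ (1 : B), hp.flip_one, rightSliceₗ_apply, rightSlice_counit] at h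
      refine Eq.trans ?_ h
      induction Coalgebra.comul (R := ℂ) b with
      | zero => simp
      | add s t hs ht => simp only [map_add, hs, ht]
      | tmul u v => simp [← hp.convolve_flip, rightSliceₗ_convolve]
    · intro b
      have h := congrArg (fun c => (leftSliceₗ ∘ₗ p.flip) c) (antipodeInv_mul_comul b)
      simp only [map_smul] at h
      rw [LinearMap.comp_apply _ _ (1 : B), hp.flip_one, leftSliceₗ_apply, leftSlice_counit] at h
      refine Eq.trans ?_ h
      induction Coalgebra.comul (R := ℂ) b with
      | zero => simp
      | add s t hs ht => simp only [map_add, hs, ht]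
      | tmul u v => simp [← hp.convolve_flip, leftSliceₗ_convolve]
    · exact fun c c' => commute_rightSliceₗ_leftSliceₗ _ _
  rw [involution, involution, ← star_star (cross p _ _), hinv, star_star]

theorem involution_add (x y : A ⊗[ℂ] B) :
    involution p (x + y) = involution p x + involution p y := by
  simp [involution]

theorem involution_zero : involution p (0 : A ⊗[ℂ] B) = 0 := by simp [involution]

theorem cross_antipodeInv_tmul (a : A) (b : B) :
    cross p (antipodeInv B) (a ⊗ₜ b) = mul p (1 ⊗ₜ b) (a ⊗ₜ 1) := by
  rw [mul_tmul, LinearMap.mulLeft_one, LinearMap.mulRight_one, TensorProduct.map_id,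
    LinearMap.id_apply]

theorem involution_tmul_eq_mul (a : A) (b : B) :
    involution p (a ⊗ₜ b) = mul p (1 ⊗ₜ star b) (star a ⊗ₜ 1) := by
  rw [involution_tmul, cross_antipodeInv_tmul]

theorem cross_tmul_one (hp : IsHopfPairing p) {T : B →ₗ[ℂ] B} (hT : T 1 = 1) (a : A) :
    cross p T (a ⊗ₜ 1) = a ⊗ₜ 1 := by
  rw [cross_eq_twistRight_twistLeft, twistLeft_tmul, Bialgebra.comul_one,
    Algebra.TensorProduct.one_def, TensorProduct.map_tmul, twistRight_tmul, LinearMap.id_apply,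
    Bialgebra.comul_one, Algebra.TensorProduct.one_def, TensorProduct.comm_tmul,
    TensorProduct.map_tmul]
  simp only [LinearMap.flip_apply, LinearMap.comp_apply, hT]
  rw [hp.flip_one, leftSliceₗ_apply, rightSliceₗ_apply, leftSlice_counit, rightSlice_counit]
  rfl

theorem cross_one_tmul (hp : IsHopfPairing p) (b : B) :
    cross p (antipodeInv B) (1 ⊗ₜ b) = 1 ⊗ₜ b := by
  have h1 : (rightSliceₗ ∘ₗ p.flip).flip 1 =
      LinearMap.toSpanSingleton ℂ A 1 ∘ₗ Coalgebra.counit := by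
    ext c
    simp only [LinearMap.flip_apply, LinearMap.comp_apply, rightSliceₗ_apply, rightSlice_one,
      hp.one_left, LinearMap.toSpanSingleton_apply]
  have h2 : (leftSliceₗ ∘ₗ p.flip ∘ₗ antipodeInv B).flip 1 =
      LinearMap.toSpanSingleton ℂ A 1 ∘ₗ Coalgebra.counit := by
    ext c
    simp only [LinearMap.flip_apply, LinearMap.comp_apply, leftSliceₗ_apply, leftSlice_one,
      ← hp.antipodeInv_left, antipodeInv_one, hp.one_left, LinearMap.toSpanSingleton_apply]
  have h3 : ∀ t : B ⊗[ℂ] B, TensorProduct.map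
      (LinearMap.toSpanSingleton ℂ A 1 ∘ₗ Coalgebra.counit) LinearMap.id t =
      (1 : A) ⊗ₜ[ℂ] TensorProduct.lid ℂ B (TensorProduct.map Coalgebra.counit LinearMap.id t) := by
    intro t
    induction t with
    | zero => simp
    | add s t hs ht => simp only [map_add, TensorProduct.tmul_add, hs, ht]
    | tmul x y => simp [TensorProduct.smul_tmul]
  have h4 : ∀ t : B ⊗[ℂ] B, TensorProduct.lid ℂ B
      (TensorProduct.map Coalgebra.counit LinearMap.id (TensorProduct.comm ℂ B B t)) =
      TensorProduct.rid ℂ B (TensorProduct.map LinearMap.id Coalgebra.counit t) := by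
    intro t
    induction t with
    | zero => simp
    | add s t hs ht => simp only [map_add, hs, ht]
    | tmul x y => simp
  have h5 := LinearMap.congr_fun (leftSlice_counit (C := B)) b
  have h6 := LinearMap.congr_fun (rightSlice_counit (C := B)) b
  simp only [leftSlice, rightSlice, LinearMap.comp_apply, LinearEquiv.coe_coe,
    LinearMap.id_apply] at h5 h6
  rw [cross_eq_twistRight_twistLeft, twistLeft_tmul, h1, h3, h5, twistRight_tmul, h2, h3, h4, h6]

theorem tmul_one_mul (hp : IsHopfPairing p) (a a' : A) (b : B) :
    mul p (a ⊗ₜ 1) (a' ⊗ₜ b) = (a * a') ⊗ₜ b := by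
  rw [mul_tmul, cross_tmul_one hp antipodeInv_one]
  simp

theorem mul_one_tmul (hp : IsHopfPairing p) (a : A) (b b' : B) :
    mul p (a ⊗ₜ b) (1 ⊗ₜ b') = a ⊗ₜ (b * b') := by
  rw [mul_tmul, cross_one_tmul hp]
  simp

theorem one_mul_eq (hp : IsHopfPairing p) (x : A ⊗[ℂ] B) : mul p (1 ⊗ₜ 1) x = x := by
  induction x with
  | zero => simp
  | add x y hx hy => rw [map_add, hx, hy]
  | tmul a b => rw [tmul_one_mul hp, one_mul]

theorem mul_one_eq (hp : IsHopfPairing p) (x : A ⊗[ℂ] B) : mul p x (1 ⊗ₜ 1) = x := by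
  induction x with
  | zero => simp
  | add x y hx hy => rw [map_add, LinearMap.add_apply, hx, hy]
  | tmul a b => rw [mul_one_tmul hp, mul_one]

theorem involution_one (hp : IsHopfPairing p) : involution p (1 ⊗ₜ 1 : A ⊗[ℂ] B) = 1 ⊗ₜ 1 := by
  rw [involution_tmul, star_one, star_one, cross_one_tmul hp]

theorem involution_inclA_mul (hp : IsHopfPairing p) (a : A) (x : A ⊗[ℂ] B) :
    involution p (mul p (a ⊗ₜ 1) x) = mul p (involution p x) (star a ⊗ₜ 1) := by
  induction x with
  | zero => simp [involution_zero]
  | add x y hx hy => simp only [map_add, involution_add, LinearMap.add_apply, hx, hy]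
  | tmul a' b =>
    rw [tmul_one_mul hp, involution_tmul_eq_mul, involution_tmul_eq_mul, star_mul,
      mul_mul_inclA hp]

theorem involution_mul_inclB (hp : IsHopfPairing p) (b : B) (x : A ⊗[ℂ] B) :
    involution p (mul p x (1 ⊗ₜ b)) = mul p (1 ⊗ₜ star b) (involution p x) := by
  induction x with
  | zero => simp [involution_zero]
  | add x y hx hy => simp only [map_add, involution_add, LinearMap.add_apply, hx, hy]
  | tmul a b' =>
    rw [mul_one_tmul hp, involution_tmul_eq_mul, involution_tmul_eq_mul, star_mul,
      mul_inclB_mul hp]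

theorem involution_inclB_mul (hp : IsHopfPairing p) (b : B) (x : A ⊗[ℂ] B) :
    involution p (mul p (1 ⊗ₜ b) x) = mul p (involution p x) (1 ⊗ₜ star b) := by
  have h := involution_mul_inclB hp (star b) (involution p x)
  rw [star_star, involution_involution hp] at h
  rw [← h, involution_involution hp]

/-! ### The functional `θ` -/

variable {φA : A →ₗ[ℂ] ℂ} {φB : B →ₗ[ℂ] ℂ}

theorem theta_tmul (a : A) (b : B) : theta φA φB (a ⊗ₜ b) = φA a * φB b := by
  simp [theta]

theorem theta_eq (φA : A →ₗ[ℂ] ℂ) (φB : B →ₗ[ℂ] ℂ) :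
    theta φA φB = LinearMap.mul' ℂ ℂ ∘ₗ TensorProduct.map φA φB :=
  TensorProduct.ext' fun a b => by simp [theta_tmul]

theorem theta_map (f : A →ₗ[ℂ] A) (g : B →ₗ[ℂ] B) (x : A ⊗[ℂ] B) :
    theta φA φB (TensorProduct.map f g x) = theta (φA ∘ₗ f) (φB ∘ₗ g) x := by
  induction x with
  | zero => simp
  | add x y hx hy => simp only [map_add, hx, hy]
  | tmul a b => simp [theta_tmul]

theorem theta_twistLeft
    (hφB : IsInvariantIntegral Coalgebra.comul 1 (HopfAlgebra.antipode ℂ) φB)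
    {κ : B →ₗ[ℂ] Module.End ℂ A} (hκ : κ 1 = 1) (x : A ⊗[ℂ] B) :
    theta φA φB (twistLeft κ x) = theta φA φB x := by
  induction x with
  | zero => simp
  | add x y hx hy => simp only [map_add, hx, hy]
  | tmul a b =>
    have h : theta φA φB (twistLeft κ (a ⊗ₜ b)) = φA (κ (rightSlice φB b) a) := by
      rw [twistLeft_tmul]
      simp only [rightSlice, LinearMap.comp_apply, LinearEquiv.coe_coe]
      induction Coalgebra.comul (R := ℂ) b with
      | zero => simp
      | add x y hx hy => simp only [map_add, LinearMap.add_apply, hx, hy]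
      | tmul x y => simp [theta_tmul, mul_comm]
    rw [h, hφB.rightSlice_eq, map_smul, hκ, theta_tmul]
    simp [mul_comm]

theorem theta_twistRight
    (hφB : IsInvariantIntegral Coalgebra.comul 1 (HopfAlgebra.antipode ℂ) φB)
    {κ : B →ₗ[ℂ] Module.End ℂ A} (hκ : κ 1 = 1) (x : A ⊗[ℂ] B) :
    theta φA φB (twistRight κ x) = theta φA φB x := by
  induction x with
  | zero => simp
  | add x y hx hy => simp only [map_add, hx, hy]
  | tmul a b =>
    have h : theta φA φB (twistRight κ (a ⊗ₜ b)) = φA (κ (leftSlice φB b) a) := by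
      rw [twistRight_tmul]
      simp only [leftSlice, LinearMap.comp_apply, LinearEquiv.coe_coe]
      induction Coalgebra.comul (R := ℂ) b with
      | zero => simp
      | add x y hx hy => simp only [map_add, LinearMap.add_apply, hx, hy]
      | tmul x y => simp [theta_tmul, mul_comm]
    rw [h, hφB.leftSlice_eq, map_smul, hκ, theta_tmul]
    simp [mul_comm]

/-- The invariance of `φ_B` removes the outer legs of `b`. No property of `φ_A` is used, so that `φ_A`
may be replaced by `φ_A(a ·)`. -/
theorem theta_cross (hp : IsHopfPairing p)
    (hφB : IsInvariantIntegral Coalgebra.comul 1 (HopfAlgebra.antipode ℂ) φB)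
    {T : B →ₗ[ℂ] B} (hT : T 1 = 1) (x : A ⊗[ℂ] B) :
    theta φA φB (cross p T x) = theta φA φB x := by
  rw [cross_eq_twistRight_twistLeft, theta_twistRight hφB, theta_twistLeft hφB]
  · rw [LinearMap.comp_apply, hp.flip_one, rightSliceₗ_apply, rightSlice_counit]; rfl
  · rw [LinearMap.comp_apply, LinearMap.comp_apply, hT, hp.flip_one, leftSliceₗ_apply,
      leftSlice_counit]
    rfl

/-- On products `x y*`, the functional `θ` agrees with `φ_A ⊗ φ_B` on the tensor product of the
`*`-algebras `A` and `B`: the invariance of `φ_B` absorbs the commutation of `B` past `A`. -/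
theorem theta_mul_involution (hp : IsHopfPairing p)
    (hφB : IsInvariantIntegral Coalgebra.comul 1 (HopfAlgebra.antipode ℂ) φB)
    (x y : A ⊗[ℂ] B) :
    theta φA φB (mul p x (involution p y)) = theta φA φB (x * star y) := by
  induction x with
  | zero => simp
  | add x x' hx hx' => simp only [map_add, LinearMap.add_apply, add_mul, hx, hx']
  | tmul a b =>
    induction y with
    | zero => simp [involution_zero]
    | add y y' hy hy' => simp only [involution_add, map_add, star_add, mul_add, hy, hy']
    | tmul a' b' =>
      rw [involution_tmul_eq_mul, mul_tmul_left, ← mul_inclB_mul hp, ← cross_antipodeInv_tmul,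
        theta_map, LinearMap.comp_id, theta_cross hp hφB antipodeInv_one, TensorProduct.star_tmul,
        Algebra.TensorProduct.tmul_mul_tmul, theta_tmul, theta_tmul]
      rfl

theorem theta_mul_involution_pos (hp : IsHopfPairing p)
    (hφA : IsInvariantIntegral Coalgebra.comul 1 (HopfAlgebra.antipode ℂ) φA) (hφA1 : φA 1 = 1)
    (hφB : IsInvariantIntegral Coalgebra.comul 1 (HopfAlgebra.antipode ℂ) φB) (hφB1 : φB 1 = 1)
    {x : A ⊗[ℂ] B} (hx : x ≠ 0) : 0 < theta φA φB (mul p x (involution p x)) := by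
  let _ := FiniteHopfCStar.cstarAlgebra A
  let _ := FiniteHopfCStar.cstarAlgebra B
  rw [theta_mul_involution hp hφB]
  obtain ⟨u, hu⟩ := exists_eq_sum_tmul_basis (Module.finBasis ℂ B) (star x)
  obtain ⟨m, z, hz, hz0⟩ := exists_map_star_mul_self_eq_sum (hφA.isPositiveFunctional hφA1) u
    (Module.finBasis ℂ B)
  rw [← hu, star_star] at hz
  have hθ : ∀ t : A ⊗[ℂ] B, theta φA φB t =
      φB (TensorProduct.lid ℂ B (TensorProduct.map φA LinearMap.id t)) := by
    intro t
    induction t with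
    | zero => simp
    | add s t hs ht => simp only [map_add, hs, ht]
    | tmul a b => simp [theta_tmul]
  have hnn : ∀ k ∈ Finset.univ, 0 ≤ φB (star (z k) * z k) :=
    fun k _ => hφB.isPositiveFunctional hφB1 (z k)
  rw [hθ, hz, map_sum]
  refine lt_of_le_of_ne (Finset.sum_nonneg hnn) fun h0 => hx ?_
  have hzk : ∀ k, z k = 0 := by
    intro k
    by_contra hk
    exact (hφB.apply_star_mul_self_pos hφB1 hk).ne'
      ((Finset.sum_eq_zero_iff_of_nonneg hnn).1 h0.symm k (Finset.mem_univ k))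
  have huk : ∀ i, u i = 0 := by
    intro i
    by_contra hi
    exact (hφA.apply_star_mul_self_pos hφA1 hi).ne'
      (hz0 (Module.finBasis ℂ B).linearIndependent hzk i)
  rw [← star_eq_zero, hu]
  simp [huk]

theorem theta_involution_mul_pos (hp : IsHopfPairing p)
    (hφA : IsInvariantIntegral Coalgebra.comul 1 (HopfAlgebra.antipode ℂ) φA) (hφA1 : φA 1 = 1)
    (hφB : IsInvariantIntegral Coalgebra.comul 1 (HopfAlgebra.antipode ℂ) φB) (hφB1 : φB 1 = 1)
    {x : A ⊗[ℂ] B} (hx : x ≠ 0) : 0 < theta φA φB (mul p (involution p x) x) := by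
  have h := theta_mul_involution_pos hp hφA hφA1 hφB hφB1 (x := involution p x) (by
    intro h
    rw [← involution_involution hp x, h, involution_zero] at hx
    exact hx rfl)
  rwa [involution_involution hp] at h

theorem theta_involution_mul_nonneg (hp : IsHopfPairing p)
    (hφA : IsInvariantIntegral Coalgebra.comul 1 (HopfAlgebra.antipode ℂ) φA) (hφA1 : φA 1 = 1)
    (hφB : IsInvariantIntegral Coalgebra.comul 1 (HopfAlgebra.antipode ℂ) φB) (hφB1 : φB 1 = 1)
    (x : A ⊗[ℂ] B) : 0 ≤ theta φA φB (mul p (involution p x) x) := by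
  rcases eq_or_ne x 0 with rfl | hx
  · simp
  · exact (theta_involution_mul_pos hp hφA hφA1 hφB hφB1 hx).le

/-- A unital `*`-embedding `i` of a finite Hopf C*-algebra into the double which carries `θ` to a
faithful positive functional is isometric for the C*-norms. -/
theorem cstarNorm_eq_norm {X : Type*} [NormedRing X] [StarRing X] [HopfAlgebra ℂ X]
    [FiniteHopfCStar X] (hp : IsHopfPairing p)
    (hφA : IsInvariantIntegral Coalgebra.comul 1 (HopfAlgebra.antipode ℂ) φA) (hφA1 : φA 1 = 1)
    (hφB : IsInvariantIntegral Coalgebra.comul 1 (HopfAlgebra.antipode ℂ) φB) (hφB1 : φB 1 = 1)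
    (i : X →ₗ[ℂ] A ⊗[ℂ] B) (hone : i 1 = 1 ⊗ₜ 1) (hmul : ∀ c d, mul p (i c) (i d) = i (c * d))
    (hstar : ∀ c x, involution p (mul p (i c) x) = mul p (involution p x) (i (star c)))
    (hpos : ∀ c, c ≠ 0 → 0 < theta φA φB (i (star c * c))) (c : X) :
    cstarNorm p φA φB (i c) = ‖c‖ := by
  let _ := FiniteHopfCStar.cstarAlgebra X
  have := FiniteHopfCStar.nontrivial X
  have hnn := theta_involution_mul_nonneg hp hφA hφA1 hφB hφB1
  have hsq : ∀ x, gnsNorm p φA φB x ^ 2 = (theta φA φB (mul p (involution p x) x)).re :=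
    fun x => Real.sq_sqrt (Complex.nonneg_iff.1 (hnn x)).1
  have hg0 : ∀ x, 0 ≤ gnsNorm p φA φB x := fun x => Real.sqrt_nonneg _
  have hmove : ∀ d x, mul p (involution p (mul p (i d) x)) (mul p (i d) x) =
      mul p (involution p x) (mul p (i (star d * d)) x) := by
    intro d x
    rw [hstar, mul_associative hp, ← mul_associative hp (i (star d)), hmul]
  have hgi : ∀ d, gnsNorm p φA φB (i d) ^ 2 = (theta φA φB (i (star d * d))).re := by
    intro d
    have h := hmove d (1 ⊗ₜ 1)
    rw [mul_one_eq hp, mul_one_eq hp, involution_one hp, one_mul_eq hp] at h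
    rw [hsq, h]
  refine IsLeast.csInf_eq ⟨⟨norm_nonneg c, fun x => ?_⟩, fun C hC => ?_⟩
  · obtain ⟨d, hd⟩ := exists_norm_sq_sub_star_mul_self c
    have h1 := (Complex.nonneg_iff.1 (hnn (mul p (i d) x))).1
    rw [hmove, ← hd, map_sub, map_smul, hone, map_sub, map_smul, LinearMap.sub_apply,
      LinearMap.smul_apply, one_mul_eq hp, map_sub, map_smul, ← hmove, map_sub, map_smul,
      Complex.sub_re, ← hsq, smul_eq_mul, Complex.re_ofReal_mul, ← hsq] at h1
    refine abs_le_of_sq_le_sq' ?_ (mul_nonneg (norm_nonneg c) (hg0 x)) |>.2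
    rw [mul_pow]
    linarith
  · -- An eigenvector of `c* c` for the eigenvalue `‖c‖²` attains the norm.
    obtain ⟨y, hy0, hy⟩ := exists_star_mul_self_mul_eq c
    have h1 := hC.2 (i y)
    have h2 : gnsNorm p φA φB (i (c * y)) ^ 2 = ‖c‖ ^ 2 * gnsNorm p φA φB (i y) ^ 2 := by
      rw [hgi, hgi, star_mul, mul_assoc, ← mul_assoc (star c), hy, mul_smul_comm, map_smul, map_smul,
        smul_eq_mul, Complex.re_ofReal_mul]
    have h3 : 0 < gnsNorm p φA φB (i y) ^ 2 := by
      rw [hgi]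
      exact (Complex.pos_iff.1 (hpos y hy0)).1
    rw [hmul] at h1
    have h4 : gnsNorm p φA φB (i (c * y)) ^ 2 ≤ (C * gnsNorm p φA φB (i y)) ^ 2 := by
      have := hg0 (i (c * y))
      gcongr
    rw [h2, mul_pow] at h4
    exact abs_le_of_sq_le_sq' (le_of_mul_le_mul_right h4 h3) hC.1 |>.2

/-- Invariance of `θ` for a coproduct `(a, b) ↦ f(a)₁₃ Δ(b)₂₄`, where `φ_A` is invariant under `f` on
both sides; `f` is the coproduct of `A` or its opposite. -/
theorem isInvariantIntegral_theta
    (hφB : IsInvariantIntegral Coalgebra.comul 1 (HopfAlgebra.antipode ℂ) φB)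
    {f : A →ₗ[ℂ] A ⊗[ℂ] A} {S : A ⊗[ℂ] B →ₗ[ℂ] A ⊗[ℂ] B}
    (hl : ∀ a, TensorProduct.lid ℂ A (TensorProduct.map φA LinearMap.id (f a)) = φA a • (1 : A))
    (hr : ∀ a, TensorProduct.rid ℂ A (TensorProduct.map LinearMap.id φA (f a)) = φA a • (1 : A))
    (hS : ∀ x, theta φA φB (S x) = theta φA φB x) :
    IsInvariantIntegral ((TensorProduct.tensorTensorTensorComm ℂ A A B B).toLinearMap ∘ₗ
      TensorProduct.map f Coalgebra.comul) (1 ⊗ₜ 1) S (theta φA φB) where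
  antipode_inv := hS
  left_inv x := by
    have key : ∀ s t, TensorProduct.lid ℂ (A ⊗[ℂ] B) (TensorProduct.map (theta φA φB) LinearMap.id
        (TensorProduct.tensorTensorTensorComm ℂ A A B B (s ⊗ₜ t))) =
        TensorProduct.lid ℂ A (TensorProduct.map φA LinearMap.id s) ⊗ₜ[ℂ]
          TensorProduct.lid ℂ B (TensorProduct.map φB LinearMap.id t) := by
      intro s t
      induction s with
      | zero => simp
      | add s s' hs hs' => simp only [map_add, TensorProduct.add_tmul, hs, hs']
      | tmul a a' =>
        induction t with
        | zero => simp
        | add t t' ht ht' => simp only [map_add, TensorProduct.tmul_add, ht, ht']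
        | tmul b b' => simp [theta_tmul, TensorProduct.smul_tmul', smul_smul, mul_comm]
    induction x with
    | zero => simp
    | add x y hx hy => simp only [map_add, add_smul, hx, hy]
    | tmul a b =>
      rw [LinearMap.comp_apply, TensorProduct.map_tmul, LinearEquiv.coe_coe, key, hl,
        hφB.left_inv, TensorProduct.smul_tmul_smul, theta_tmul]
  right_inv x := by
    have key : ∀ s t, TensorProduct.rid ℂ (A ⊗[ℂ] B) (TensorProduct.map LinearMap.id (theta φA φB)
        (TensorProduct.tensorTensorTensorComm ℂ A A B B (s ⊗ₜ t))) =
        TensorProduct.rid ℂ A (TensorProduct.map LinearMap.id φA s) ⊗ₜ[ℂ]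
          TensorProduct.rid ℂ B (TensorProduct.map LinearMap.id φB t) := by
      intro s t
      induction s with
      | zero => simp
      | add s s' hs hs' => simp only [map_add, TensorProduct.add_tmul, hs, hs']
      | tmul a a' =>
        induction t with
        | zero => simp
        | add t t' ht ht' => simp only [map_add, TensorProduct.tmul_add, ht, ht']
        | tmul b b' => simp [theta_tmul, TensorProduct.smul_tmul', smul_smul, mul_comm]
    induction x with
    | zero => simp
    | add x y hx hy => simp only [map_add, add_smul, hx, hy]
    | tmul a b =>
      rw [LinearMap.comp_apply, TensorProduct.map_tmul, LinearEquiv.coe_coe, key, hr,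
        hφB.right_inv, TensorProduct.smul_tmul_smul, theta_tmul]

theorem isInvariantIntegral_theta_comul (hp : IsHopfPairing p)
    (hφA : IsInvariantIntegral Coalgebra.comul 1 (HopfAlgebra.antipode ℂ) φA)
    (hφB : IsInvariantIntegral Coalgebra.comul 1 (HopfAlgebra.antipode ℂ) φB) :
    IsInvariantIntegral (comul A B) (1 ⊗ₜ 1) (antipode p) (theta φA φB) := by
  refine isInvariantIntegral_theta hφB hφA.left_inv hφA.right_inv fun x => ?_
  have hA : φA ∘ₗ HopfAlgebra.antipode ℂ = φA := LinearMap.ext hφA.antipode_inv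
  have hB : φB ∘ₗ HopfAlgebra.antipode ℂ = φB := LinearMap.ext hφB.antipode_inv
  rw [antipode, LinearMap.comp_apply, theta_map, hA, hB,
    theta_cross hp hφB HopfAlgebra.antipode_one]

theorem isInvariantIntegral_theta_comulCop (hp : IsHopfPairing p)
    (hφA : IsInvariantIntegral Coalgebra.comul 1 (HopfAlgebra.antipode ℂ) φA)
    (hφB : IsInvariantIntegral Coalgebra.comul 1 (HopfAlgebra.antipode ℂ) φB) :
    IsInvariantIntegral (comulCop A B) (1 ⊗ₜ 1) (antipodeRev p) (theta φA φB) := by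
  have hl : ∀ t : A ⊗[ℂ] A, TensorProduct.lid ℂ A (TensorProduct.map φA LinearMap.id
      (TensorProduct.comm ℂ A A t)) =
      TensorProduct.rid ℂ A (TensorProduct.map LinearMap.id φA t) := by
    intro t
    induction t with
    | zero => simp
    | add s t hs ht => simp only [map_add, hs, ht]
    | tmul x y => simp
  have hr : ∀ t : A ⊗[ℂ] A, TensorProduct.rid ℂ A (TensorProduct.map LinearMap.id φA
      (TensorProduct.comm ℂ A A t)) =
      TensorProduct.lid ℂ A (TensorProduct.map φA LinearMap.id t) := by
    intro t
    induction t with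
    | zero => simp
    | add s t hs ht => simp only [map_add, hs, ht]
    | tmul x y => simp
  refine isInvariantIntegral_theta hφB (fun a => (hl _).trans (hφA.right_inv a))
    (fun a => (hr _).trans (hφA.left_inv a)) fun x => ?_
  induction x with
  | zero => simp
  | add x y hx hy => simp only [map_add, hx, hy]
  | tmul a b =>
    rw [antipodeRev_tmul, ← cross_antipodeInv_tmul, theta_cross hp hφB antipodeInv_one,
      theta_tmul, theta_tmul, hφA.antipode_inv, hφB.antipode_inv]

theorem theta_tmul_mul_involution (hp : IsHopfPairing p)
    (hφB : IsInvariantIntegral Coalgebra.comul 1 (HopfAlgebra.antipode ℂ) φB) (a : A) (b : B) :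
    theta φA φB (mul p (a ⊗ₜ b) (involution p (a ⊗ₜ b))) =
      φA (a * star a) * φB (b * star b) := by
  rw [theta_mul_involution hp hφB, TensorProduct.star_tmul, Algebra.TensorProduct.tmul_mul_tmul,
    theta_tmul]

theorem norm_tmul (hp : IsHopfPairing p)
    (hφA : IsInvariantIntegral Coalgebra.comul 1 (HopfAlgebra.antipode ℂ) φA) (hφA1 : φA 1 = 1)
    (hφB : IsInvariantIntegral Coalgebra.comul 1 (HopfAlgebra.antipode ℂ) φB) (a : A) (b : B) :
    norm p φA φB (a ⊗ₜ b) = integralNorm φA a * integralNorm φB b := by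
  have hA := hφA.isPositiveFunctional hφA1 (star a)
  rw [star_star] at hA
  rw [norm, theta_tmul_mul_involution hp hφB, integralNorm, integralNorm, Complex.mul_re,
    ← (Complex.nonneg_iff.1 hA).2, zero_mul, sub_zero,
    Real.sqrt_mul (Complex.nonneg_iff.1 hA).1]

end QuantumDouble

end Double

theorem mainTheorem3 {A B : Type*}
    [NormedRing A] [StarRing A] [HopfAlgebra ℂ A] [FiniteHopfCStar A]
    [NormedRing B] [StarRing B] [HopfAlgebra ℂ B] [FiniteHopfCStar B]
    (p : A →ₗ[ℂ] B →ₗ[ℂ] ℂ) (hp : IsHopfPairing p) (hnd : p.Nondegenerate)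
    (φA : A →ₗ[ℂ] ℂ) (φB : B →ₗ[ℂ] ℂ)
    (hφA : IsInvariantIntegral Coalgebra.comul 1 (HopfAlgebra.antipode ℂ) φA) (hφA1 : φA 1 = 1)
    (hφB : IsInvariantIntegral Coalgebra.comul 1 (HopfAlgebra.antipode ℂ) φB) (hφB1 : φB 1 = 1) :
    -- `θ` is `φ_A ⊗ φ_B`
    QuantumDouble.theta φA φB = LinearMap.mul' ℂ ℂ ∘ₗ TensorProduct.map φA φB ∧
    -- `θ` is a normalized invariant integral on the double
    IsInvariantIntegral (QuantumDouble.comul A B) (1 ⊗ₜ 1) (QuantumDouble.antipode p)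
      (QuantumDouble.theta φA φB) ∧
    IsInvariantIntegral (QuantumDouble.comulCop A B) (1 ⊗ₜ 1) (QuantumDouble.antipodeRev p)
      (QuantumDouble.theta φA φB) ∧
    QuantumDouble.theta φA φB (1 ⊗ₜ 1) = 1 ∧
    -- `θ` is positive and faithful, so that the norms below are norms
    (∀ x : A ⊗[ℂ] B, x ≠ 0 →
      0 < QuantumDouble.theta φA φB
        (QuantumDouble.mul p x (QuantumDouble.involution p x)) ∧
      0 < QuantumDouble.theta φA φB
        (QuantumDouble.mul p (QuantumDouble.involution p x) x)) ∧
    -- multiplicativity of the norm on elementary elements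
    (∀ (a : A) (b : B),
      QuantumDouble.theta φA φB
          (QuantumDouble.mul p (a ⊗ₜ b) (QuantumDouble.involution p (a ⊗ₜ b))) =
        φA (a * star a) * φB (b * star b) ∧
      QuantumDouble.norm p φA φB (a ⊗ₜ b) = integralNorm φA a * integralNorm φB b) ∧
    -- the canonical embeddings are isometric for the norms given by the integrals
    (∀ a : A, QuantumDouble.norm p φA φB (QuantumDouble.inclA a) = integralNorm φA a) ∧
    (∀ b : B, QuantumDouble.norm p φA φB (QuantumDouble.inclB b) = integralNorm φB b) ∧
    -- the canonical embeddings are isometric for the C*-norms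
    (∀ a : A, QuantumDouble.cstarNorm p φA φB (QuantumDouble.inclA a) = ‖a‖) ∧
    (∀ b : B, QuantumDouble.cstarNorm p φA φB (QuantumDouble.inclB b) = ‖b‖) := by
  have hnorm := QuantumDouble.norm_tmul hp hφA hφA1 hφB
  refine ⟨QuantumDouble.theta_eq φA φB,
    QuantumDouble.isInvariantIntegral_theta_comul hp hφA hφB,
    QuantumDouble.isInvariantIntegral_theta_comulCop hp hφA hφB, ?_,
    fun x hx => ⟨QuantumDouble.theta_mul_involution_pos hp hφA hφA1 hφB hφB1 hx,
      QuantumDouble.theta_involution_mul_pos hp hφA hφA1 hφB hφB1 hx⟩,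
    fun a b => ⟨QuantumDouble.theta_tmul_mul_involution hp hφB a b, hnorm a b⟩,
    fun a => ?_, fun b => ?_, ?_, ?_⟩
  · rw [QuantumDouble.theta_tmul, hφA1, hφB1, mul_one]
  · rw [QuantumDouble.inclA, hnorm]
    simp [integralNorm, hφB1]
  · rw [QuantumDouble.inclB, hnorm]
    simp [integralNorm, hφA1]
  · refine QuantumDouble.cstarNorm_eq_norm hp hφA hφA1 hφB hφB1
      ((TensorProduct.mk ℂ A B).flip 1) rfl (fun c d => ?_) (fun c x => ?_) fun c hc => ?_
    · exact QuantumDouble.tmul_one_mul hp c d 1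
    · exact QuantumDouble.involution_inclA_mul hp c x
    · rw [LinearMap.flip_apply, TensorProduct.mk_apply, QuantumDouble.theta_tmul, hφB1, mul_one]
      exact hφA.apply_star_mul_self_pos hφA1 hc
  · refine QuantumDouble.cstarNorm_eq_norm hp hφA hφA1 hφB hφB1
      (TensorProduct.mk ℂ A B 1) rfl (fun c d => ?_) (fun c x => ?_) fun c hc => ?_
    · exact QuantumDouble.mul_one_tmul hp 1 c d
    · exact QuantumDouble.involution_inclB_mul hp c x
    · rw [TensorProduct.mk_apply, QuantumDouble.theta_tmul, hφA1, one_mul]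
      exact hφB.apply_star_mul_self_pos hφB1 hc
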